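/- Lemma 3.1 (Characterization of a generalized Jacobi structure). Let $M$ be a smooth ($C^\infty$, Hausdorff, without boundary) manifold of dimension $n$, let $p\ge 1$ be an integer, let $\Lambda$ be a smooth $2p$-vector field and $E$ a smooth $(2p-1)$-vector field on $M$, regarded as alternating forms on covectors: $(X_1\wedge\dots\wedge X_k)(\alpha_1,\dots,\alpha_k)=\det(\alpha_i(X_j))$. For $f_1,\dots,f_{2p}\in C^\infty(M)$ put $$\{f_1,\dots,f_{2p}\}=\Lambda(df_1,\dots,df_{2p})-\sum_{j=1}^{2p}(-1)^j f_j\,E(df_1,\dots,\widehat{df_j},\dots,df_{2p}).$$ Then this bracket satisfies the generalized Jacobi identity $$\sum_{\sigma\in S_{4p-1}}\operatorname{sgn}(\sigma)\,\{f_{\sigma(1)},\dots,f_{\sigma(2p-1)},\{f_{\sigma(2p)},\dots,f_{\sigma(4p-1)}\}\}=0\qquad\text{for all } f_1,\dots,f_{4p-1}\in C^\infty(M)$$ if and only if $$[\Lambda,\Lambda]=2(2p-1)\,E\wedge\Lambda\quad\text{and}\quad[E,\Lambda]=0 .$$ Here $[\ ,\ ]$ is the Schouten–Nijenhuis bracket,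 with the sign convention $$[X_1\wedge\dots\wedge X_r,\,Y_1\wedge\dots\wedge Y_s]=\sum_{i,j}(-1)^{i+j}X_1\wedge\dots\widehat{X_i}\dots\wedge X_r\wedge[X_i,Y_j]\wedge Y_1\wedge\dots\widehat{Y_j}\dots\wedge Y_s ;$$ equivalently, in local coordinates, $[P,Q]=\sum_\nu\big(\iota_{dx^\nu}P\wedge\partial_\nu Q+(-1)^r\,\partial_\nu P\wedge\iota_{dx^\nu}Q\big)$ for an $r$-vector field $P$ and an $s$-vector field $Q$, where $\iota_\alpha P=P(\alpha,\dots)$ and $\partial_\nu$ differentiates components. -/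

import Mathlib

open scoped Manifold ContDiff

noncomputable section

/-- The covector (cotangent) space `T*_x M` of an `n`-manifold `M` at `x`. -/
abbrev Cotangent (n : ℕ) {M : Type*} [TopologicalSpace M]
    [ChartedSpace (EuclideanSpace ℝ (Fin n)) M] (x : M) : Type :=
  TangentSpace (𝓡 n) x →L[ℝ] ℝ

/-- The coordinate space `ℝⁿ`. -/
abbrev CoordSpace (n : ℕ) : Type := EuclideanSpace ℝ (Fin n)

/-- The dual `(ℝⁿ)*` of the coordinate space. -/
abbrev CoordDual (n : ℕ) : Type := CoordSpace n →L[ℝ] ℝ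

section PointwiseAlgebra

/-- The exterior product of alternating forms with the normalisation
`(P ∧ Q)(α₁, …, α_{a+b}) = ∑ sign(σ) P(α_{σ(1)}, …, α_{σ(a)}) Q(α_{σ(a+1)}, …, α_{σ(a+b)})`,
the sum being over the `(a, b)`-shuffles `σ`; thus `(X ∧ Y)(α, β) = α(X) β(Y) - α(Y) β(X)`. -/
def wedge {W : Type*} [AddCommGroup W] [Module ℝ W] {a b : ℕ}
    (P : W [⋀^Fin a]→ₗ[ℝ] ℝ) (Q : W [⋀^Fin b]→ₗ[ℝ] ℝ) : W [⋀^Fin (a + b)]→ₗ[ℝ] ℝ :=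
  ((LinearMap.mul' ℝ ℝ).compAlternatingMap (P.domCoprod Q)).domDomCongr finSumFinEquiv

/-- The coordinate covector `dx^ν` on `ℝⁿ`. -/
def coordCovector {n : ℕ} (ν : Fin n) : CoordDual n := EuclideanSpace.proj ν

/-- The coordinate vector `∂_ν` on `ℝⁿ`. -/
def coordVector {n : ℕ} (ν : Fin n) : CoordSpace n := EuclideanSpace.single ν 1

/-- The `ν`-th partial derivative `∂_ν P` at `y` of a multivector field `P` on `ℝⁿ` (the
components of `P` in the constant frame are differentiated). -/
def partialDeriv {n k : ℕ} (P : CoordSpace n → CoordDual n [⋀^Fin k]→L[ℝ] ℝ)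
    (ν : Fin n) (y : CoordSpace n) : CoordDual n [⋀^Fin k]→ₗ[ℝ] ℝ :=
  (fderiv ℝ P y (coordVector ν)).toAlternatingMap

/-- The contraction `ι(dx^ν) P = P(dx^ν, …)` at `y` of a multivector field `P` on `ℝⁿ`. -/
def contract {n k : ℕ} (P : CoordSpace n → CoordDual n [⋀^Fin (k + 1)]→L[ℝ] ℝ)
    (ν : Fin n) (y : CoordSpace n) : CoordDual n [⋀^Fin k]→ₗ[ℝ] ℝ :=
  (P y).toAlternatingMap.curryLeft (coordCovector ν)

/-- The Schouten–Nijenhuis bracket at `y` of an `(a+1)`-vector field `P` and a `(b+1)`-vector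
field `Q` on (an open subset of) `ℝⁿ`:
`[P, Q] = ∑_ν (ι(dx^ν) P ∧ ∂_ν Q + (-1)^(a+1) ∂_ν P ∧ ι(dx^ν) Q)`.
In components this is
`[P,Q]^K = 1/(a!(b+1)!) ε^K_{IJ} P^{νI} ∂_ν Q^J + (-1)^(a+1)/((a+1)!b!) ε^K_{IJ} Q^{νJ} ∂_ν P^I`,
i.e. the convention
`[X₁∧…∧X_r, Y₁∧…∧Y_s] = ∑ (-1)^(i+j) X₁∧…X̂_i…∧X_r ∧ [X_i, Y_j] ∧ Y₁∧…Ŷ_j…∧Y_s`. -/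
def coordSchouten {n a b : ℕ} (P : CoordSpace n → CoordDual n [⋀^Fin (a + 1)]→L[ℝ] ℝ)
    (Q : CoordSpace n → CoordDual n [⋀^Fin (b + 1)]→L[ℝ] ℝ) (y : CoordSpace n) :
    CoordDual n [⋀^Fin (a + b + 1)]→ₗ[ℝ] ℝ :=
  ∑ ν : Fin n,
    ((wedge (contract P ν y) (partialDeriv Q ν y)).domDomCongr (finCongr (by omega)) +
      (-1 : ℝ) ^ (a + 1) •
        (wedge (partialDeriv P ν y) (contract Q ν y)).domDomCongr (finCongr (by omega)))

end PointwiseAlgebra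

section Manifold

variable (n : ℕ) {M : Type*} [TopologicalSpace M] [ChartedSpace (EuclideanSpace ℝ (Fin n)) M]

/-- The pullback of covectors on `ℝⁿ` to covectors at `x` along the preferred chart at `x₀`:
`α ↦ α ∘ dφ_x`, where `φ` is the chart at `x₀`. -/
def chartPullback (x₀ x : M) : CoordDual n →L[ℝ] Cotangent n x :=
  ContinuousLinearMap.precomp ℝ
    (mfderiv (𝓡 n) 𝓘(ℝ, EuclideanSpace ℝ (Fin n)) (extChartAt (𝓡 n) x₀) x :
      TangentSpace (𝓡 n) x →L[ℝ] CoordSpace n)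

/-- The pushforward of covectors at `x` to covectors on `ℝⁿ` along the preferred chart `φ` at `x`:
`β ↦ β ∘ d(φ⁻¹)_{φ(x)}`. -/
def chartPushforward (x : M) : Cotangent n x →L[ℝ] CoordDual n :=
  ContinuousLinearMap.precomp ℝ
    (mfderiv 𝓘(ℝ, EuclideanSpace ℝ (Fin n)) (𝓡 n) (extChartAt (𝓡 n) x).symm (extChartAt (𝓡 n) x x) :
      CoordSpace n →L[ℝ] TangentSpace (𝓡 n) x)

/-- The local expression on `ℝⁿ` of a field of alternating `k`-forms on the cotangent spaces, in
the preferred chart `φ` at `x₀`:  its value on the coordinate covectors `dx^{i₁}, …, dx^{i_k}` at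
the point `y` is the component `P^{i₁ … i_k}` at `φ⁻¹(y)`. -/
def coordRep {k : ℕ} (P : ∀ x : M, Cotangent n x [⋀^Fin k]→L[ℝ] ℝ) (x₀ : M)
    (y : CoordSpace n) : CoordDual n [⋀^Fin k]→L[ℝ] ℝ :=
  (P ((extChartAt (𝓡 n) x₀).symm y)).compContinuousLinearMap
    (chartPullback n x₀ ((extChartAt (𝓡 n) x₀).symm y))

variable (M) in
/-- A smooth `k`-vector field on the `n`-manifold `M`: a field of alternating `k`-linear forms on
the cotangent spaces (equivalently, of elements of `⋀^k T_x M`) whose components in local charts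
are smooth. -/
structure MultivectorField (k : ℕ) where
  /-- the value at a point, as an alternating form on covectors -/
  toFun : ∀ x : M, Cotangent n x [⋀^Fin k]→L[ℝ] ℝ
  smooth : ∀ x₀ : M, ContDiffOn ℝ ∞ (coordRep n toFun x₀) (extChartAt (𝓡 n) x₀).target

variable {n}

/-- The exterior product `P ∧ Q` of two multivector fields, at `x`. -/
def MultivectorField.wedge {a b : ℕ} (P : MultivectorField n M a) (Q : MultivectorField n M b)
    (x : M) : Cotangent n x [⋀^Fin (a + b)]→ₗ[ℝ] ℝ :=
  _root_.wedge (P.toFun x).toAlternatingMap (Q.toFun x).toAlternatingMap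

/-- The Schouten–Nijenhuis bracket `[P, Q]` of an `(a+1)`-vector field and a `(b+1)`-vector field,
at `x`: it is computed in the chart at `x` and transported back to `x`. -/
def MultivectorField.schouten {a b : ℕ} (P : MultivectorField n M (a + 1))
    (Q : MultivectorField n M (b + 1)) (x : M) : Cotangent n x [⋀^Fin (a + b + 1)]→ₗ[ℝ] ℝ :=
  (coordSchouten (coordRep n P.toFun x) (coordRep n Q.toFun x) (extChartAt (𝓡 n) x x)).compLinearMap
    (chartPushforward n x).toLinearMap

/-- The differential `df` at `x` of a function on `M`. -/
def differential (f : M → ℝ) (x : M) : Cotangent n x :=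
  (mfderiv (𝓡 n) 𝓘(ℝ, ℝ) f x : TangentSpace (𝓡 n) x →L[ℝ] ℝ)

theorem contDiffOn_comp_extChartAt_symm [IsManifold (𝓡 n) ∞ M] {f : M → ℝ}
    (hf : ContMDiff (𝓡 n) 𝓘(ℝ, ℝ) ∞ f) (x₀ : M) :
    ContDiffOn ℝ ∞ (f ∘ (extChartAt (𝓡 n) x₀).symm) (extChartAt (𝓡 n) x₀).target :=
  (hf.comp_contMDiffOn (contMDiffOn_extChartAt_symm x₀)).contDiffOn

theorem chartPullback_differential [IsManifold (𝓡 n) ∞ M] {f : M → ℝ}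
    (hf : ContMDiff (𝓡 n) 𝓘(ℝ, ℝ) ∞ f) (x₀ : M) {x : M} (hx : x ∈ (extChartAt (𝓡 n) x₀).source) :
    chartPullback n x₀ x
      (fderiv ℝ (f ∘ (extChartAt (𝓡 n) x₀).symm) (extChartAt (𝓡 n) x₀ x)) =
      differential f x := by
  have hy : extChartAt (𝓡 n) x₀ x ∈ (extChartAt (𝓡 n) x₀).target :=
    (extChartAt (𝓡 n) x₀).map_source hx
  have h1 : DifferentiableAt ℝ (f ∘ (extChartAt (𝓡 n) x₀).symm) (extChartAt (𝓡 n) x₀ x) :=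
    ((contDiffOn_comp_extChartAt_symm hf x₀).differentiableOn (by simp)).differentiableAt
      ((isOpen_extChartAt_target x₀).mem_nhds hy)
  have h2 : MDifferentiableAt (𝓡 n) 𝓘(ℝ, CoordSpace n) (extChartAt (𝓡 n) x₀) x :=
    mdifferentiableAt_extChartAt (by simpa using hx)
  have h3 : f =ᶠ[nhds x] (f ∘ (extChartAt (𝓡 n) x₀).symm) ∘ (extChartAt (𝓡 n) x₀) := by
    filter_upwards [(isOpen_extChartAt_source (I := 𝓡 n) x₀).mem_nhds hx] with z hz
    exact (congrArg f ((extChartAt (𝓡 n) x₀).left_inv hz)).symm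
  unfold differential
  rw [h3.mfderiv_eq, mfderiv_comp x h1.mdifferentiableAt h2, mfderiv_eq_fderiv]
  rfl

theorem contMDiff_apply_differential [IsManifold (𝓡 n) ∞ M] {k : ℕ} (P : MultivectorField n M k)
    (f : Fin k → M → ℝ) (hf : ∀ i, ContMDiff (𝓡 n) 𝓘(ℝ, ℝ) ∞ (f i)) :
    ContMDiff (𝓡 n) 𝓘(ℝ, ℝ) ∞ (fun x => P.toFun x (fun i => differential (f i) x)) := by
  intro x₀
  let φ := extChartAt (𝓡 n) x₀
  let g : CoordSpace n → ℝ := fun y =>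
    coordRep n P.toFun x₀ y (fun i => fderiv ℝ (f i ∘ φ.symm) y)
  have hg : ContDiffOn ℝ ∞ g φ.target := by
    have hd : ContDiffOn ℝ ∞ (fun y => fun i => fderiv ℝ (f i ∘ φ.symm) y) φ.target :=
      contDiffOn_pi.2 fun i => (contDiffOn_comp_extChartAt_symm (hf i) x₀).fderiv_of_isOpen
        (isOpen_extChartAt_target x₀) (by simp)
    have hu : ContDiff ℝ ∞ (fun q : (CoordDual n [⋀^Fin k]→L[ℝ] ℝ) × (Fin k → CoordDual n) =>
        q.1 q.2) :=
      contDiff_iff_contDiffAt.2 fun q =>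
        ((ContinuousAlternatingMap.toContinuousMultilinearMapLI (𝕜 := ℝ) (E := CoordDual n)
          (F := ℝ) (ι := Fin k)).toContinuousLinearMap.analyticAt_uncurry_of_multilinear
            (x := q)).contDiffAt
    exact hu.comp_contDiffOn ((P.smooth x₀).prodMk hd)
  have hfg : (fun x => P.toFun x (fun i => differential (f i) x)) =ᶠ[nhds x₀] g ∘ φ := by
    filter_upwards [(isOpen_extChartAt_source (I := 𝓡 n) x₀).mem_nhds
      (mem_extChartAt_source (I := 𝓡 n) x₀)] with z hz
    have key : ∀ w : M, w = z → P.toFun z (fun i => differential (f i) z) =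
        P.toFun w (fun i => chartPullback n x₀ w (fderiv ℝ (f i ∘ φ.symm) (φ z))) := by
      rintro w rfl
      congr 1
      funext i
      exact (chartPullback_differential (hf i) x₀ hz).symm
    exact key _ (φ.left_inv hz)
  refine ContMDiffAt.congr_of_eventuallyEq ?_ hfg
  have hgat : ContMDiffAt 𝓘(ℝ, CoordSpace n) 𝓘(ℝ, ℝ) ∞ g (φ x₀) :=
    (hg.contDiffAt ((isOpen_extChartAt_target x₀).mem_nhds
      (mem_extChartAt_target (I := 𝓡 n) x₀))).contMDiffAt
  exact hgat.comp x₀ contMDiffAt_extChartAt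

/-- The bracket of `k + 1` functions defined by a `(k+1)`-vector field `Λ` and a `k`-vector field
`E`: `{f₁, …, f_{k+1}} = Λ(df₁, …, df_{k+1}) - ∑_j (-1)^j f_j E(df₁, …, omit df_j, …, df_{k+1})`.
The index `j : Fin (k + 1)` starts at `0`, hence the exponent `j + 1`. -/
def genJacobiBracket [IsManifold (𝓡 n) ∞ M] {k : ℕ} (Λ : MultivectorField n M (k + 1))
    (E : MultivectorField n M k) (f : Fin (k + 1) → C^∞⟮𝓡 n, M; 𝓘(ℝ, ℝ), ℝ⟯) :
    C^∞⟮𝓡 n, M; 𝓘(ℝ, ℝ), ℝ⟯ where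
  val x := Λ.toFun x (fun i => differential (f i) x) -
    ∑ j : Fin (k + 1), (-1 : ℝ) ^ ((j : ℕ) + 1) * f j x *
      E.toFun x (fun i => differential (f (j.succAbove i)) x)
  property := by
    refine (contMDiff_apply_differential Λ _ fun i => (f i).contMDiff).sub
      (contMDiff_finsetSum fun j _ => ((contMDiff_const).mul (f j).contMDiff).mul
        (contMDiff_apply_differential E _ fun i => (f (j.succAbove i)).contMDiff))

/-- The generalized Jacobi identity for a bracket of `k + 1` functions: for all smooth functions
`f₁, …, f_{2k+1}`,
`∑_σ sign(σ) {f_{σ(1)}, …, f_{σ(k)}, {f_{σ(k+1)}, …, f_{σ(2k+1)}}} = 0`. -/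
def GenJacobiIdentity {k : ℕ}
    (br : (Fin (k + 1) → C^∞⟮𝓡 n, M; 𝓘(ℝ, ℝ), ℝ⟯) → C^∞⟮𝓡 n, M; 𝓘(ℝ, ℝ), ℝ⟯) : Prop :=
  ∀ f : Fin (k + (k + 1)) → C^∞⟮𝓡 n, M; 𝓘(ℝ, ℝ), ℝ⟯,
    ∑ σ : Equiv.Perm (Fin (k + (k + 1))), ((Equiv.Perm.sign σ : ℤ) : ℝ) •
      br (Fin.snoc (α := fun _ => C^∞⟮𝓡 n, M; 𝓘(ℝ, ℝ), ℝ⟯)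
        (fun i : Fin k => f (σ (Fin.castAdd (k + 1) i)))
        (br (fun i : Fin (k + 1) => f (σ (Fin.natAdd k i))))) = 0

end Manifold

end

/-! Put k = 2p - 1. The pair (Λ, E) is one alternating form D of degree k + 1 on 1-jets (f, df) in ℝ
× T*, and the bracket is D evaluated on the jets of its arguments. With e = (1, 0), contraction
gives ι_e D = E, while D restricted to covectors is Λ.

In a chart the jet of an inner bracket involves the derivative of the coefficients of D and the
derivatives of its arguments. In the alternating sum the Hessian terms are symmetric under exchange
of two blocks of k letters. That exchange has sign (-1)^k = -1, so these terms cancel. What remains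
depends only on the 1-jets (`jacobi_sum_eq`): up to the nonzero factor k!(k+1)!, it is the
alternating form η = k ι_e D ∧ D - ∑_ν ι_{dx^ν} D ∧ ∂_ν D.

Every family of 1-jets at a point comes from global smooth functions (`exists_smooth_coordJet_eq`),
so the Jacobi identity says that η vanishes at each point. A form on ℝ × T* vanishes exactly when
its restriction to T* and the restriction of its contraction with e do
(`alternatingMap_prod_eq_zero`). The restriction of η gives ∑_ν ι_{dx^ν} Λ ∧ ∂_ν Λ = k E ∧ Λ, where
the left side is half of [Λ, Λ]. The contraction gives [E, Λ] = 0, because ι_e ι_e D = 0 and E ∧ E =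
0 in odd degree (`jetForm_jacobi_iff`, `coordSchouten_iff`). -/

/-! ### Alternating sums and insertion of an entry into a block -/

/-- Expansion of an alternating sum along its first argument. -/
theorem sum_sign_mul_cons {W : Type*} {N : ℕ} (F : (Fin (N + 1) → W) → ℝ) (u : W) (w : Fin N → W) :
    ∑ σ : Equiv.Perm (Fin (N + 1)), ((Equiv.Perm.sign σ : ℤ) : ℝ) *
        F (fun i => (Fin.cons u w : Fin (N + 1) → W) (σ i)) =
      ∑ p : Fin (N + 1), (-1 : ℝ) ^ (p : ℕ) * ∑ τ : Equiv.Perm (Fin N),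
        ((Equiv.Perm.sign τ : ℤ) : ℝ) * F (Fin.insertNth p u fun i => w (τ i)) := by
  -- A permutation is determined by the position p that it sends to 0 and by the permutation τ it
  -- induces on the remaining letters. The cycle bringing p to the front contributes the sign
  -- (-1)^p.
  let g : Fin (N + 1) × Equiv.Perm (Fin N) → Equiv.Perm (Fin (N + 1)) := fun q =>
    Equiv.Perm.decomposeFin.symm (0, q.2) * Fin.cycleRange q.1
  have hself : ∀ q, g q q.1 = 0 := fun q => by
    simp only [g, Equiv.Perm.mul_apply, Fin.cycleRange_self]
    simp
  have habove : ∀ q i, g q (q.1.succAbove i) = (q.2 i).succ := fun q i => by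
    simp only [g, Equiv.Perm.mul_apply, Fin.cycleRange_succAbove]
    simp
  have hg : Function.Bijective g := by
    refine (Fintype.bijective_iff_injective_and_card g).2 ⟨?_, ?_⟩
    · rintro ⟨p, τ⟩ ⟨p', τ'⟩ h
      have hp : p = p' := (g (p, τ)).injective ((hself (p, τ)).trans
        ((hself (p', τ')).symm.trans (congrFun (congrArg DFunLike.coe h.symm) p')))
      subst hp
      congr 1
      ext1 i
      refine Fin.succ_injective _ ?_
      rw [← habove (p, τ), ← habove (p, τ'), h]
    · simp [Fintype.card_perm, Nat.factorial_succ]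
  rw [← Equiv.sum_comp (Equiv.ofBijective g hg), Fintype.sum_prod_type]
  refine Finset.sum_congr rfl fun p _ => ?_
  rw [Finset.mul_sum]
  refine Finset.sum_congr rfl fun τ _ => ?_
  have hsign : ((Equiv.Perm.sign (g (p, τ)) : ℤ) : ℝ) =
      (-1 : ℝ) ^ (p : ℕ) * ((Equiv.Perm.sign τ : ℤ) : ℝ) := by
    simp [g, Fin.sign_cycleRange, Equiv.Perm.decomposeFin.symm_sign, mul_comm]
  have hfun : (fun i => (Fin.cons u w : Fin (N + 1) → W) (g (p, τ) i)) =
      Fin.insertNth p u fun i => w (τ i) := by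
    refine (Fin.eq_insertNth_iff).2 ⟨?_, ?_⟩
    · simp [hself (p, τ)]
    · funext i
      simp [Fin.removeNth, habove (p, τ)]
  rw [Equiv.ofBijective_apply, hsign, hfun, mul_assoc]

/-- Inserting an entry into the first of two consecutive blocks: the first block. -/
theorem insertNth_castAdd_comp_castAdd {W : Type*} {a b : ℕ} (i : Fin (a + 1)) (u : W)
    (x : Fin (a + 1 + b) → W) (j : Fin (a + 1)) :
    (Fin.insertNth (Fin.castAdd (b + 1) i : Fin (a + 1 + b + 1)) u x : Fin (a + 1 + b + 1) → W)
      (Fin.castAdd (b + 1) j) = (Fin.insertNth i u (fun j : Fin a => x ⟨j, by omega⟩) :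
        Fin (a + 1) → W) j := by
  suffices h : (fun j : Fin (a + 1) =>
    (Fin.insertNth (Fin.castAdd (b + 1) i : Fin (a + 1 + b + 1)) u x : Fin (a + 1 + b + 1) → W)
      (Fin.castAdd (b + 1) j)) =
      Fin.insertNth i u (fun j => x ⟨j, by omega⟩) from congrFun h j
  refine Fin.eq_insertNth_iff.2 ⟨?_, ?_⟩
  · exact Fin.insertNth_apply_same _ _ _
  · funext j
    have h : Fin.castAdd (b + 1) (i.succAbove j) =
        (Fin.castAdd (b + 1) i : Fin (a + 1 + b + 1)).succAbove
          (⟨j, by omega⟩ : Fin (a + 1 + b)) := by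
      ext
      simp only [Fin.succAbove, Fin.lt_def, Fin.val_castSucc, Fin.val_castAdd]
      split_ifs <;> simp
    simp only [Fin.removeNth]
    rw [h]
    exact Fin.insertNth_apply_succAbove _ _ _ _

/-- Inserting an entry into the first of two consecutive blocks: the second block. -/
theorem insertNth_castAdd_comp_natAdd {W : Type*} {a b : ℕ} (i : Fin (a + 1)) (u : W)
    (x : Fin (a + 1 + b) → W) (j : Fin (b + 1)) :
    (Fin.insertNth (Fin.castAdd (b + 1) i : Fin (a + 1 + b + 1)) u x : Fin (a + 1 + b + 1) → W)
      (Fin.natAdd (a + 1) j) = x ⟨a + j, by omega⟩ := by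
  have h : Fin.natAdd (a + 1) j =
      (Fin.castAdd (b + 1) i : Fin (a + 1 + b + 1)).succAbove
        (⟨a + j, by omega⟩ : Fin (a + 1 + b)) := by
    have := i.2
    ext
    simp only [Fin.succAbove, Fin.lt_def, Fin.val_castSucc, Fin.val_castAdd, Fin.val_natAdd]
    rw [if_neg (by omega)]
    change a + 1 + (j : ℕ) = a + j + 1
    omega
  rw [h]
  exact Fin.insertNth_apply_succAbove _ _ _ _

/-- Inserting an entry into the second of two consecutive blocks: the first block. -/
theorem insertNth_natAdd_comp_castAdd {W : Type*} {a b : ℕ} (i : Fin (b + 1)) (u : W)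
    (x : Fin (a + b) → W) (j : Fin a) :
    (Fin.insertNth (Fin.natAdd a i : Fin (a + b + 1)) u x : Fin (a + b + 1) → W)
      (Fin.castAdd (b + 1) j) = x (Fin.castAdd b j) := by
  have h : Fin.castAdd (b + 1) j =
      (Fin.natAdd a i : Fin (a + b + 1)).succAbove (Fin.castAdd b j) := by
    have := j.2
    ext
    simp only [Fin.succAbove, Fin.lt_def, Fin.val_castSucc, Fin.val_castAdd, Fin.val_natAdd]
    rw [if_pos (by omega)]
    simp
  rw [h]
  exact Fin.insertNth_apply_succAbove _ _ _ _

/-- Inserting an entry into the second of two consecutive blocks: the second block. -/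
theorem insertNth_natAdd_comp_natAdd {W : Type*} {a b : ℕ} (i : Fin (b + 1)) (u : W)
    (x : Fin (a + b) → W) (j : Fin (b + 1)) :
    (Fin.insertNth (Fin.natAdd a i : Fin (a + b + 1)) u x : Fin (a + b + 1) → W)
      (Fin.natAdd a j) = (Fin.insertNth i u (fun j : Fin b => x (Fin.natAdd a j)) :
        Fin (b + 1) → W) j := by
  suffices h : (fun j : Fin (b + 1) =>
    (Fin.insertNth (Fin.natAdd a i : Fin (a + b + 1)) u x : Fin (a + b + 1) → W)
      (Fin.natAdd a j)) =
      Fin.insertNth i u (fun j => x (Fin.natAdd a j)) from congrFun h j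
  refine Fin.eq_insertNth_iff.2 ⟨?_, ?_⟩
  · exact Fin.insertNth_apply_same _ _ _
  · funext j
    have h : Fin.natAdd a (i.succAbove j) =
        (Fin.natAdd a i : Fin (a + b + 1)).succAbove (Fin.natAdd a j) := by
      ext
      simp only [Fin.succAbove, Fin.lt_def, Fin.val_castSucc, Fin.val_natAdd]
      split_ifs <;> first | omega | simp [add_assoc]
    simp only [Fin.removeNth]
    rw [h]
    exact Fin.insertNth_apply_succAbove _ _ _ _

/-! ### Exterior product: permutation formula, commutation, contraction -/

section WedgeAlgebra

variable {W : Type*} [AddCommGroup W] [Module ℝ W]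

/-- The exterior product as an alternating sum over all permutations. -/
theorem factorial_mul_wedge_apply {a b : ℕ} (P : W [⋀^Fin a]→ₗ[ℝ] ℝ) (Q : W [⋀^Fin b]→ₗ[ℝ] ℝ)
    (v : Fin (a + b) → W) :
    ((a.factorial * b.factorial : ℕ) : ℝ) * wedge P Q v =
      ∑ σ : Equiv.Perm (Fin (a + b)), ((Equiv.Perm.sign σ : ℤ) : ℝ) *
        (P (fun i => v (σ (Fin.castAdd b i))) * Q (fun i => v (σ (Fin.natAdd a i)))) := by
  -- Summing over all permutations counts each shuffle a! b! times.
  have h := congrArg (fun f => LinearMap.mul' ℝ ℝ (f (v ∘ finSumFinEquiv)))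
    (MultilinearMap.domCoprod_alternization_eq P Q)
  simp only [Fintype.card_fin, MultilinearMap.alternatization_apply, AlternatingMap.smul_apply,
    map_sum, map_nsmul] at h
  rw [nsmul_eq_mul] at h
  refine h.symm.trans ?_
  rw [← Equiv.sum_comp (Equiv.permCongr (finSumFinEquiv (m := a) (n := b)))]
  refine Finset.sum_congr rfl fun σ _ => ?_
  rw [Equiv.Perm.sign_permCongr]
  rcases Int.units_eq_one_or (Equiv.Perm.sign σ) with hσ | hσ <;>
    simp [hσ, Equiv.permCongr_apply]

theorem wedge_compLinearMap {V : Type*} [AddCommGroup V] [Module ℝ V] {a b : ℕ}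
    (P : W [⋀^Fin a]→ₗ[ℝ] ℝ) (Q : W [⋀^Fin b]→ₗ[ℝ] ℝ) (f : V →ₗ[ℝ] W) :
    (wedge P Q).compLinearMap f = wedge (P.compLinearMap f) (Q.compLinearMap f) := by
  ext v
  have h0 : ((a.factorial * b.factorial : ℕ) : ℝ) ≠ 0 :=
    Nat.cast_ne_zero.2 (Nat.mul_ne_zero a.factorial_ne_zero b.factorial_ne_zero)
  refine mul_left_cancel₀ h0 ?_
  rw [AlternatingMap.compLinearMap_apply, factorial_mul_wedge_apply, factorial_mul_wedge_apply]
  rfl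

/-- Exchanging two consecutive blocks is a power of the cyclic rotation, which makes its sign
computable. -/
theorem val_finRotate_pow (N j : ℕ) (i : Fin N) : ((finRotate N ^ j) i : ℕ) = (i + j) % N := by
  obtain _ | N := N
  · exact i.elim0
  induction j with
  | zero => simp [Nat.mod_eq_of_lt i.2]
  | succ j ih =>
    rw [pow_succ', Equiv.Perm.mul_apply, finRotate_apply, Fin.val_add, ih, Fin.val_one',
      ← Nat.add_mod, add_assoc]

/-- The sign of the permutation exchanging two consecutive blocks. -/
theorem sign_finAddFlip_trans_finCongr (a b : ℕ) :
    Equiv.Perm.sign ((finAddFlip (m := a) (n := b)).trans (finCongr (add_comm b a))) =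
      (-1) ^ (a * b) := by
  have h : (finAddFlip (m := a) (n := b)).trans (finCongr (add_comm b a)) =
      finRotate (a + b) ^ b := by
    ext i
    rw [val_finRotate_pow]
    refine Fin.addCases (fun i => ?_) (fun i => ?_) i
    · have := i.2
      simp [Nat.mod_eq_of_lt (show b + (i : ℕ) < a + b by omega), add_comm (i : ℕ)]
    · have := i.2
      simp [show a + (i : ℕ) + b = i + (a + b) by ring,
        Nat.mod_eq_of_lt (show (i : ℕ) < a + b by omega)]
  rw [h, map_pow, sign_finRotate, ← pow_mul]
  rcases b with _ | b
  · simp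
  · rw [show (a + (b + 1) - 1) * (b + 1) = a * (b + 1) + b * (b + 1) by
      rw [← add_assoc, Nat.add_sub_cancel, add_mul], pow_add,
      (Nat.even_mul_succ_self b).neg_one_pow, mul_one]

/-- Reindexing the permutation sum by the exchange of the two blocks turns one side into the other;
the sign of that exchange is (-1)^(ab). -/
theorem wedge_comm {a b : ℕ} (P : W [⋀^Fin a]→ₗ[ℝ] ℝ) (Q : W [⋀^Fin b]→ₗ[ℝ] ℝ) :
    (wedge P Q).domDomCongr (finCongr (add_comm a b)) = (-1 : ℝ) ^ (a * b) • wedge Q P := by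
  ext v
  have h0 : ((a.factorial * b.factorial : ℕ) : ℝ) ≠ 0 :=
    Nat.cast_ne_zero.2 (Nat.mul_ne_zero a.factorial_ne_zero b.factorial_ne_zero)
  refine mul_left_cancel₀ h0 ?_
  rw [AlternatingMap.domDomCongr_apply, factorial_mul_wedge_apply, AlternatingMap.smul_apply,
    smul_eq_mul, mul_left_comm, mul_comm a.factorial, factorial_mul_wedge_apply,
    ← Equiv.sum_comp (Equiv.equivCongr (finAddFlip (m := a) (n := b)).symm
      (finCongr (add_comm b a))), Finset.mul_sum]
  refine Finset.sum_congr rfl fun σ _ => ?_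
  rw [Equiv.Perm.sign_equivCongr, Equiv.symm_symm, sign_finAddFlip_trans_finCongr]
  simp [Equiv.equivCongr]
  ring

theorem neg_one_pow_mul_insertNth {a : ℕ} (P : W [⋀^Fin (a + 1)]→ₗ[ℝ] ℝ) (i : Fin (a + 1)) (u : W)
    (x : Fin a → W) :
    (-1 : ℝ) ^ (i : ℕ) * P (Fin.insertNth i u x) = P.curryLeft u x := by
  simpa using P.neg_one_pow_smul_map_insertNth i u x

theorem apply_snoc {a : ℕ} (P : W [⋀^Fin (a + 1)]→ₗ[ℝ] ℝ) (u : W) (x : Fin a → W) :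
    P (Fin.snoc (α := fun _ => W) x u) = (-1 : ℝ) ^ a * P.curryLeft u x := by
  have h := P.map_insertNth (Fin.last a) u x
  rw [Fin.insertNth_last'] at h
  simpa using h

/-- Contraction with a vector is an antiderivation of the exterior product. -/
theorem wedge_cons {a b : ℕ} (P : W [⋀^Fin (a + 1)]→ₗ[ℝ] ℝ) (Q : W [⋀^Fin (b + 1)]→ₗ[ℝ] ℝ)
    (u : W) (w : Fin (a + 1 + b) → W) :
    wedge P Q (Fin.cons u w : Fin (a + 1 + b + 1) → W) =
      wedge (P.curryLeft u) Q (fun i => w (i.cast (by omega))) +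
        (-1 : ℝ) ^ (a + 1) * wedge P (Q.curryLeft u) w := by
  have h0 : (((a + 1).factorial * (b + 1).factorial : ℕ) : ℝ) ≠ 0 :=
    Nat.cast_ne_zero.2 (Nat.mul_ne_zero (a + 1).factorial_ne_zero (b + 1).factorial_ne_zero)
  refine mul_left_cancel₀ h0 ?_
  have hL : ((a.factorial * (b + 1).factorial : ℕ) : ℝ) *
      wedge (P.curryLeft u) Q (fun i => w (i.cast (by omega))) =
      ∑ τ : Equiv.Perm (Fin (a + 1 + b)), ((Equiv.Perm.sign τ : ℤ) : ℝ) *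
        (P.curryLeft u (fun j => w (τ ⟨j, by omega⟩)) * Q (fun j => w (τ ⟨a + j, by omega⟩))) := by
    rw [factorial_mul_wedge_apply,
      ← Equiv.sum_comp (Equiv.permCongr (finCongr (by omega : a + 1 + b = a + (b + 1))))]
    refine Finset.sum_congr rfl fun τ _ => ?_
    rw [Equiv.Perm.sign_permCongr]
    rfl
  have hR := factorial_mul_wedge_apply P (Q.curryLeft u) w
  rw [factorial_mul_wedge_apply]
  refine (sum_sign_mul_cons (fun v : Fin (a + 1 + b + 1) → W =>
    P (fun i => v (Fin.castAdd (b + 1) i)) * Q (fun i => v (Fin.natAdd (a + 1) i))) u w).trans ?_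
  rw [show (∑ p : Fin (a + 1 + b + 1), _ : ℝ) = _ from Fin.sum_univ_add (a := a + 1) (b := b + 1) _]
  -- Every position of u inside the first block contributes the same amount, since moving u to the
  -- front of P absorbs the sign. The a + 1 positions turn a! into (a + 1)!. The second block
  -- behaves alike, with the extra sign (-1)^(a+1) for passing P.
  have h1 : ∀ i : Fin (a + 1), (-1 : ℝ) ^ (i : ℕ) * ∑ τ : Equiv.Perm (Fin (a + 1 + b)),
      ((Equiv.Perm.sign τ : ℤ) : ℝ) * (P (Fin.insertNth i u fun j => w (τ ⟨j, by omega⟩)) *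
        Q (fun j => w (τ ⟨a + j, by omega⟩))) = ((a.factorial * (b + 1).factorial : ℕ) : ℝ) *
      wedge (P.curryLeft u) Q (fun i => w (i.cast (by omega))) := fun i => by
    rw [hL, Finset.mul_sum]
    refine Finset.sum_congr rfl fun τ _ => ?_
    rw [← neg_one_pow_mul_insertNth P i]
    ring
  have h2 : ∀ i : Fin (b + 1), (-1 : ℝ) ^ (a + 1 + (i : ℕ)) * ∑ τ : Equiv.Perm (Fin (a + 1 + b)),
      ((Equiv.Perm.sign τ : ℤ) : ℝ) * (P (fun j => w (τ (Fin.castAdd b j))) *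
        Q (Fin.insertNth i u fun j => w (τ (Fin.natAdd (a + 1) j)))) =
      (-1 : ℝ) ^ (a + 1) * ((((a + 1).factorial * b.factorial : ℕ) : ℝ) *
      wedge P (Q.curryLeft u) w) := fun i => by
    rw [hR, Finset.mul_sum, Finset.mul_sum]
    refine Finset.sum_congr rfl fun τ _ => ?_
    rw [← neg_one_pow_mul_insertNth Q i]
    ring
  simp only [insertNth_castAdd_comp_castAdd, insertNth_castAdd_comp_natAdd,
    insertNth_natAdd_comp_castAdd, insertNth_natAdd_comp_natAdd, Fin.val_castAdd, Fin.val_natAdd,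
    h1, h2]
  simp only [Finset.sum_const, Finset.card_univ, Fintype.card_fin, nsmul_eq_mul,
    Nat.factorial_succ]
  push_cast
  ring

end WedgeAlgebra

/-! ### Exchange of the two outer blocks -/

/-- The permutation of `k + (k + 1)` letters exchanging the first `k` with the last `k`. -/
def outerBlockSwap (k : ℕ) : Equiv.Perm (Fin (k + (k + 1))) :=
  Function.Involutive.toPerm
    (fun i => if h : i.1 < k then ⟨i.1 + (k + 1), by omega⟩ else
      if i.1 = k then i else ⟨i.1 - (k + 1), by omega⟩) (by
    intro i
    ext
    rcases lt_trichotomy i.1 k with h | h | h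
    · have h1 : ¬ i.1 + (k + 1) < k := by omega
      have h2 : i.1 + (k + 1) ≠ k := by omega
      simp only [h, h1, h2, dite_true, dite_false, if_false]
      omega
    · simp [h]
    · have h1 : ¬ i.1 < k := by omega
      have h2 : i.1 ≠ k := by omega
      have h3 : i.1 - (k + 1) < k := by omega
      simp only [h1, h2, h3, dite_true, dite_false, if_false]
      omega)

theorem outerBlockSwap_apply {k : ℕ} (i : Fin (k + (k + 1))) :
    outerBlockSwap k i = if h : i.1 < k then ⟨i.1 + (k + 1), by omega⟩ else
      if i.1 = k then i else ⟨i.1 - (k + 1), by omega⟩ := rfl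

theorem outerBlockSwap_castAdd {k : ℕ} (i : Fin k) :
    outerBlockSwap k (Fin.castAdd (k + 1) i) = Fin.natAdd k i.succ := by
  ext
  rw [outerBlockSwap_apply, dif_pos (by simp)]
  simp only [Fin.val_castAdd, Fin.val_natAdd, Fin.val_succ]
  omega

theorem outerBlockSwap_natAdd_zero (k : ℕ) :
    outerBlockSwap k (Fin.natAdd k 0) = Fin.natAdd k 0 := by
  rw [outerBlockSwap_apply, dif_neg (by simp), if_pos (by simp)]

theorem outerBlockSwap_natAdd_succ {k : ℕ} (i : Fin k) :
    outerBlockSwap k (Fin.natAdd k i.succ) = Fin.castAdd (k + 1) i := by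
  rw [← outerBlockSwap_castAdd]
  exact Function.Involutive.toPerm_involutive _ _

/-- An involution of 2k + 1 letters with a single fixed point is a product of k transpositions. -/
theorem sign_outerBlockSwap (k : ℕ) : Equiv.Perm.sign (outerBlockSwap k) = (-1) ^ k := by
  have h2 : outerBlockSwap k ^ 2 = 1 := by
    ext1 i
    exact Function.Involutive.toPerm_involutive _ _
  have h1 : Fintype.card (Function.fixedPoints (outerBlockSwap k)) = 1 := by
    refine Fintype.card_eq_one_iff.2 ⟨⟨Fin.natAdd k 0, outerBlockSwap_natAdd_zero k⟩, ?_⟩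
    rintro ⟨i, hi⟩
    refine Subtype.ext ?_
    revert hi
    refine Fin.addCases (fun i hi => ?_) (fun i => Fin.cases (fun _ => rfl) (fun i hi => ?_) i) i
    · have h := congrArg Fin.val ((outerBlockSwap_castAdd i).symm.trans hi)
      simp at h
      omega
    · have h := congrArg Fin.val ((outerBlockSwap_natAdd_succ i).symm.trans hi)
      simp at h
      omega
  rw [Equiv.Perm.sign_of_pow_two_eq_one h2, h1, Fintype.card_fin]
  congr 1
  omega

/-- Exchanging the two outer blocks in an alternating sum. -/
theorem sum_sign_mul_outerBlockSwap {k : ℕ}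
    (G : Fin (k + (k + 1)) → (Fin k → Fin (k + (k + 1))) → (Fin k → Fin (k + (k + 1))) → ℝ) :
    ∑ σ : Equiv.Perm (Fin (k + (k + 1))), ((Equiv.Perm.sign σ : ℤ) : ℝ) *
        G (σ (Fin.natAdd k 0)) (fun i => σ (Fin.castAdd (k + 1) i))
          (fun i => σ (Fin.natAdd k i.succ)) =
      (-1 : ℝ) ^ k * ∑ σ : Equiv.Perm (Fin (k + (k + 1))), ((Equiv.Perm.sign σ : ℤ) : ℝ) *
        G (σ (Fin.natAdd k 0)) (fun i => σ (Fin.natAdd k i.succ))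
          (fun i => σ (Fin.castAdd (k + 1) i)) := by
  rw [← Equiv.sum_comp (Equiv.mulRight (outerBlockSwap k)), Finset.mul_sum]
  refine Finset.sum_congr rfl fun σ _ => ?_
  simp only [Equiv.coe_mulRight, Equiv.Perm.mul_apply, outerBlockSwap_castAdd,
    outerBlockSwap_natAdd_zero, outerBlockSwap_natAdd_succ, Equiv.Perm.sign_mul,
    sign_outerBlockSwap]
  push_cast
  ring

/-! ### The Jacobi sum at a point and the cancellation of Hessians -/

section JacobiSum

variable {U : Type*} [AddCommGroup U] [Module ℝ U]

/-- In an alternating sum, replacing any argument of the second block by a vector depending on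
its index gives the same result as replacing the first argument. -/
theorem sum_sign_mul_update {k : ℕ} (A : (Fin k → Fin (k + (k + 1))) → ℝ)
    (D : U [⋀^Fin (k + 1)]→ₗ[ℝ] ℝ) (v g : Fin (k + (k + 1)) → U) (i : Fin (k + 1)) :
    ∑ σ : Equiv.Perm (Fin (k + (k + 1))), ((Equiv.Perm.sign σ : ℤ) : ℝ) *
        (A (fun j => σ (Fin.castAdd (k + 1) j)) *
          D (Function.update (fun j => v (σ (Fin.natAdd k j))) i (g (σ (Fin.natAdd k i))))) =
      ∑ σ : Equiv.Perm (Fin (k + (k + 1))), ((Equiv.Perm.sign σ : ℤ) : ℝ) *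
        (A (fun j => σ (Fin.castAdd (k + 1) j)) *
          D.curryLeft (g (σ (Fin.natAdd k 0))) (fun j => v (σ (Fin.natAdd k j.succ)))) := by
  -- Reindex by the transposition of positions 0 and i of the second block. Its sign appears twice,
  -- once from the permutation and once from the alternation of D, and so disappears.
  rw [← Equiv.sum_comp (Equiv.mulRight (Equiv.swap (Fin.natAdd k 0) (Fin.natAdd k i)))]
  refine Finset.sum_congr rfl fun σ _ => ?_
  have hne : ∀ j : Fin k, ∀ l : Fin (k + 1), Fin.castAdd (k + 1) j ≠ Fin.natAdd k l := by
    intro j l h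
    have := congrArg Fin.val h
    simp at this
    omega
  have hA : (fun j : Fin k => (σ * Equiv.swap (Fin.natAdd k 0) (Fin.natAdd k i))
      (Fin.castAdd (k + 1) j)) = fun j => σ (Fin.castAdd (k + 1) j) := by
    funext j
    rw [Equiv.Perm.mul_apply, Equiv.swap_apply_of_ne_of_ne (hne j 0) (hne j i)]
  have hswap : ∀ j : Fin (k + 1), Equiv.swap (Fin.natAdd k 0) (Fin.natAdd k i) (Fin.natAdd k j) =
      Fin.natAdd k (Equiv.swap 0 i j) := fun j =>
    ((Fin.natAdd_injective (k + 1) k).map_swap 0 i j).symm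
  have hs : Equiv.Perm.sign (Equiv.swap (Fin.natAdd k 0) (Fin.natAdd k i)) =
      Equiv.Perm.sign (Equiv.swap 0 i) := by
    simp [Equiv.Perm.sign_swap', (Fin.natAdd_injective (k + 1) k).eq_iff]
  have hD : Function.update (fun j : Fin (k + 1) => v (σ (Fin.natAdd k (Equiv.swap 0 i j)))) i
      (g (σ (Fin.natAdd k 0))) = (Fin.cons (g (σ (Fin.natAdd k 0)))
        (fun j => v (σ (Fin.natAdd k j.succ))) : Fin (k + 1) → U) ∘ Equiv.swap 0 i := by
    funext j
    by_cases hj : j = i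
    · subst hj
      simp
    · rw [Function.update_of_ne hj, Function.comp_apply]
      have h0 : Equiv.swap 0 i j ≠ 0 := fun h => hj (by
        rw [← Equiv.swap_apply_left 0 i] at h
        simpa using congrArg (Equiv.swap 0 i) h)
      obtain ⟨l, hl⟩ := Fin.exists_succ_eq.2 h0
      rw [← hl, Fin.cons_succ]
  simp only [Equiv.coe_mulRight, hA, Equiv.Perm.sign_mul, hs]
  simp only [Equiv.Perm.mul_apply, hswap, Equiv.swap_apply_right]
  rw [hD, D.map_perm]
  have hsq : ((Equiv.Perm.sign (Equiv.swap 0 i) : ℤ) : ℝ) *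
      ((Equiv.Perm.sign (Equiv.swap 0 i) : ℤ) : ℝ) = 1 := by
    rcases Int.units_eq_one_or (Equiv.Perm.sign (Equiv.swap 0 i)) with h | h <;> simp [h]
  rw [Units.smul_def, zsmul_eq_mul]
  change _ * (_ * (_ * D.curryLeft (g (σ (Fin.natAdd k 0)))
    (fun j => v (σ (Fin.natAdd k j.succ))))) = _
  push_cast
  linear_combination (((Equiv.Perm.sign σ : ℤ) : ℝ) * A (fun j => σ (Fin.castAdd (k + 1) j)) *
    D.curryLeft (g (σ (Fin.natAdd k 0))) (fun j => v (σ (Fin.natAdd k j.succ)))) * hsq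

/-- For odd `k`, symmetric pairings of the two outer blocks cancel in an alternating sum. -/
theorem sum_sign_mul_symm_eq_zero {k : ℕ} (hk : Odd k)
    (G : Fin (k + (k + 1)) → (Fin k → Fin (k + (k + 1))) → (Fin k → Fin (k + (k + 1))) → ℝ)
    (hG : ∀ i x y, G i x y = G i y x) :
    ∑ σ : Equiv.Perm (Fin (k + (k + 1))), ((Equiv.Perm.sign σ : ℤ) : ℝ) *
        G (σ (Fin.natAdd k 0)) (fun i => σ (Fin.castAdd (k + 1) i))
          (fun i => σ (Fin.natAdd k i.succ)) = 0 := by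
  have h := sum_sign_mul_outerBlockSwap G
  have h' : ∑ σ : Equiv.Perm (Fin (k + (k + 1))), ((Equiv.Perm.sign σ : ℤ) : ℝ) *
        G (σ (Fin.natAdd k 0)) (fun i => σ (Fin.natAdd k i.succ))
          (fun i => σ (Fin.castAdd (k + 1) i)) =
      ∑ σ : Equiv.Perm (Fin (k + (k + 1))), ((Equiv.Perm.sign σ : ℤ) : ℝ) *
        G (σ (Fin.natAdd k 0)) (fun i => σ (Fin.castAdd (k + 1) i))
          (fun i => σ (Fin.natAdd k i.succ)) :=
    Finset.sum_congr rfl fun σ _ => by rw [hG]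
  rw [hk.neg_one_pow, h'] at h
  linarith

theorem curryLeft_sum_smul_apply {n k : ℕ} (D : U [⋀^Fin (k + 1)]→ₗ[ℝ] ℝ) (t : Fin n → ℝ)
    (d : Fin n → U) (x : Fin k → U) :
    D.curryLeft (∑ ν, t ν • d ν) x = ∑ ν, t ν * D.curryLeft (d ν) x := by
  let φ : U →ₗ[ℝ] ℝ :=
    { toFun := fun u => D.curryLeft u x
      map_add' := fun u u' => by rw [map_add]; rfl
      map_smul' := fun c u => by rw [map_smul]; rfl }
  change φ _ = _
  rw [map_sum]
  exact Finset.sum_congr rfl fun ν _ => φ.map_smul _ _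

/-- The alternating sum of the generalized Jacobi identity at a point, in terms of `1`-jets
`v i = a i • e + ∑ ν, c i ν • dx ν` and Hessians `H i`: the second-order terms cancel. -/
theorem jacobi_sum_eq {n k : ℕ} (hk : Odd k) (D : U [⋀^Fin (k + 1)]→ₗ[ℝ] ℝ)
    (D' : Fin n → U [⋀^Fin (k + 1)]→ₗ[ℝ] ℝ) (e : U) (dx : Fin n → U)
    (v : Fin (k + (k + 1)) → U) (a : Fin (k + (k + 1)) → ℝ) (c : Fin (k + (k + 1)) → Fin n → ℝ)
    (H : Fin (k + (k + 1)) → Fin n → Fin n → ℝ)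
    (hv : ∀ i, v i = a i • e + ∑ ν, c i ν • dx ν) (hH : ∀ i ν μ, H i ν μ = H i μ ν) :
    ∑ σ : Equiv.Perm (Fin (k + (k + 1))), ((Equiv.Perm.sign σ : ℤ) : ℝ) *
      D (Fin.snoc (α := fun _ => U) (fun i => v (σ (Fin.castAdd (k + 1) i)))
        (D (fun i => v (σ (Fin.natAdd k i))) • e +
          ∑ ν, (D' ν (fun i => v (σ (Fin.natAdd k i))) +
            ∑ i, D (Function.update (fun i => v (σ (Fin.natAdd k i))) i
              (c (σ (Fin.natAdd k i)) ν • e + ∑ μ, H (σ (Fin.natAdd k i)) ν μ • dx μ))) • dx ν)) =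
    ((k.factorial * (k + 1).factorial : ℕ) : ℝ) *
      (k * wedge (D.curryLeft e) D v - ∑ ν, wedge (D.curryLeft (dx ν)) (D' ν) v) := by
  have hsnoc : ∀ (x : Fin k → U) (b : ℝ) (t : Fin n → ℝ),
      D (Fin.snoc (α := fun _ => U) x (b • e + ∑ ν, t ν • dx ν)) =
        -(D.curryLeft e x * b + ∑ ν, D.curryLeft (dx ν) x * t ν) := by
    intro x b t
    rw [apply_snoc, hk.neg_one_pow, map_add, AlternatingMap.add_apply, curryLeft_sum_smul_apply]
    simp [mul_comm]
  have hcons : ∀ (x : Fin k → U) (b : ℝ) (t : Fin n → ℝ),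
      D.curryLeft (b • e + ∑ ν, t ν • dx ν) x =
        b * D.curryLeft e x + ∑ ν, t ν * D.curryLeft (dx ν) x := by
    intro x b t
    rw [map_add, AlternatingMap.add_apply, curryLeft_sum_smul_apply]
    simp
  -- the terms in which the inner bracket is differentiated through its arguments
  have hT : ∑ σ : Equiv.Perm (Fin (k + (k + 1))), ((Equiv.Perm.sign σ : ℤ) : ℝ) *
      ∑ ν, D.curryLeft (dx ν) (fun i => v (σ (Fin.castAdd (k + 1) i))) *
        ∑ i, D (Function.update (fun i => v (σ (Fin.natAdd k i))) i
          (c (σ (Fin.natAdd k i)) ν • e + ∑ μ, H (σ (Fin.natAdd k i)) ν μ • dx μ)) =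
      -((k + 1 : ℝ) * (((k.factorial * (k + 1).factorial : ℕ) : ℝ) *
        wedge (D.curryLeft e) D v)) := by
    -- Differentiating any slot of the inner bracket has the same effect as differentiating its
    -- first slot; the k + 1 slots produce the factor k + 1.
    have h1 : ∀ (ν : Fin n) (i : Fin (k + 1)), ∑ σ : Equiv.Perm (Fin (k + (k + 1))),
        ((Equiv.Perm.sign σ : ℤ) : ℝ) *
          (D.curryLeft (dx ν) (fun i => v (σ (Fin.castAdd (k + 1) i))) *
          D (Function.update (fun i => v (σ (Fin.natAdd k i))) i
          (c (σ (Fin.natAdd k i)) ν • e + ∑ μ, H (σ (Fin.natAdd k i)) ν μ • dx μ))) =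
        ∑ σ : Equiv.Perm (Fin (k + (k + 1))), ((Equiv.Perm.sign σ : ℤ) : ℝ) *
          (D.curryLeft (dx ν) (fun i => v (σ (Fin.castAdd (k + 1) i))) *
          (c (σ (Fin.natAdd k 0)) ν * D.curryLeft e (fun j => v (σ (Fin.natAdd k j.succ))) +
            ∑ μ, H (σ (Fin.natAdd k 0)) ν μ *
              D.curryLeft (dx μ) (fun j => v (σ (Fin.natAdd k j.succ))))) := by
      intro ν i
      refine (sum_sign_mul_update (fun x => D.curryLeft (dx ν) (fun i => v (x i))) D v
        (fun l => c l ν • e + ∑ μ, H l ν μ • dx μ) i).trans ?_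
      simp only [hcons]
    -- Since ∑_ν c_ν dx^ν = v - a e, the first-order terms reassemble into a contraction with v, up
    -- to a correction in a.
    have h2 : ∀ σ : Equiv.Perm (Fin (k + (k + 1))),
        ∑ ν, (D.curryLeft (dx ν) (fun i => v (σ (Fin.castAdd (k + 1) i))) *
          (c (σ (Fin.natAdd k 0)) ν * D.curryLeft e (fun j => v (σ (Fin.natAdd k j.succ))) +
            ∑ μ, H (σ (Fin.natAdd k 0)) ν μ *
              D.curryLeft (dx μ) (fun j => v (σ (Fin.natAdd k j.succ))))) =
        D.curryLeft (v (σ (Fin.natAdd k 0))) (fun i => v (σ (Fin.castAdd (k + 1) i))) *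
          D.curryLeft e (fun j => v (σ (Fin.natAdd k j.succ))) +
        ((∑ ν, ∑ μ, H (σ (Fin.natAdd k 0)) ν μ *
          (D.curryLeft (dx ν) (fun i => v (σ (Fin.castAdd (k + 1) i))) *
            D.curryLeft (dx μ) (fun j => v (σ (Fin.natAdd k j.succ))))) -
          a (σ (Fin.natAdd k 0)) * (D.curryLeft e (fun i => v (σ (Fin.castAdd (k + 1) i))) *
            D.curryLeft e (fun j => v (σ (Fin.natAdd k j.succ))))) := by
      intro σ
      rw [hv (σ (Fin.natAdd k 0)), hcons]
      simp only [mul_add, Finset.sum_add_distrib, add_mul, Finset.sum_mul, Finset.mul_sum]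
      have e1 : ∀ ν, D.curryLeft (dx ν) (fun i => v (σ (Fin.castAdd (k + 1) i))) *
          (c (σ (Fin.natAdd k 0)) ν * D.curryLeft e (fun j => v (σ (Fin.natAdd k j.succ)))) =
          c (σ (Fin.natAdd k 0)) ν * D.curryLeft (dx ν) (fun i => v (σ (Fin.castAdd (k + 1) i))) *
            D.curryLeft e (fun j => v (σ (Fin.natAdd k j.succ))) := fun ν => by ring
      have e2 : ∀ ν μ, D.curryLeft (dx ν) (fun i => v (σ (Fin.castAdd (k + 1) i))) *
          (H (σ (Fin.natAdd k 0)) ν μ *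
            D.curryLeft (dx μ) (fun j => v (σ (Fin.natAdd k j.succ)))) =
          H (σ (Fin.natAdd k 0)) ν μ *
            (D.curryLeft (dx ν) (fun i => v (σ (Fin.castAdd (k + 1) i))) *
              D.curryLeft (dx μ) (fun j => v (σ (Fin.natAdd k j.succ)))) := fun ν μ => by ring
      simp only [e1, e2]
      ring
    -- Both the Hessian terms and the correction in a are symmetric in the two outer blocks, so they
    -- vanish for odd k.
    have h3 := sum_sign_mul_symm_eq_zero hk (fun i x y =>
      (∑ ν, ∑ μ, H i ν μ * (D.curryLeft (dx ν) (fun j => v (x j)) *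
        D.curryLeft (dx μ) (fun j => v (y j)))) -
      a i * (D.curryLeft e (fun j => v (x j)) * D.curryLeft e (fun j => v (y j)))) (by
        intro i x y
        rw [Finset.sum_comm]
        congr 1
        · refine Finset.sum_congr rfl fun ν _ => Finset.sum_congr rfl fun μ _ => ?_
          rw [hH i μ ν, mul_comm (D.curryLeft (dx μ) _)]
        · rw [mul_comm (D.curryLeft e _)])
    -- After the exchange of outer blocks, the middle letter and the block next to it fill all slots
    -- of D, leaving ι_e D ∧ D with sign (-1)^k.
    have h4 : ∑ σ : Equiv.Perm (Fin (k + (k + 1))), ((Equiv.Perm.sign σ : ℤ) : ℝ) *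
        (D.curryLeft (v (σ (Fin.natAdd k 0))) (fun i => v (σ (Fin.castAdd (k + 1) i))) *
          D.curryLeft e (fun j => v (σ (Fin.natAdd k j.succ)))) =
        -(((k.factorial * (k + 1).factorial : ℕ) : ℝ) * wedge (D.curryLeft e) D v) := by
      refine (sum_sign_mul_outerBlockSwap (fun i x y => D.curryLeft (v i) (fun j => v (x j)) *
        D.curryLeft e (fun j => v (y j)))).trans ?_
      rw [factorial_mul_wedge_apply, hk.neg_one_pow, neg_one_mul]
      congr 1
      refine Finset.sum_congr rfl fun σ _ => ?_
      rw [mul_comm (D.curryLeft e _)]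
      have h5 : (fun i => v (σ (Fin.natAdd k i))) = Matrix.vecCons (v (σ (Fin.natAdd k 0)))
          (fun i => v (σ (Fin.natAdd k i.succ))) := by
        funext i
        refine Fin.cases rfl (fun i => rfl) i
      rw [h5]
      rfl
    simp only [Finset.mul_sum]
    rw [Finset.sum_comm]
    refine (Finset.sum_congr rfl fun ν _ =>
      Finset.sum_comm.trans (Finset.sum_congr rfl fun i _ => h1 ν i)).trans ?_
    simp only [Finset.sum_const, Finset.card_univ, Fintype.card_fin, nsmul_eq_mul]
    rw [← Finset.mul_sum, Finset.sum_comm]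
    simp only [← Finset.mul_sum, h2]
    simp only [mul_add, Finset.sum_add_distrib, h3, h4]
    push_cast
    ring
  have hσ : ∀ σ : Equiv.Perm (Fin (k + (k + 1))), ((Equiv.Perm.sign σ : ℤ) : ℝ) *
      D (Fin.snoc (α := fun _ => U) (fun i => v (σ (Fin.castAdd (k + 1) i)))
        (D (fun i => v (σ (Fin.natAdd k i))) • e +
          ∑ ν, (D' ν (fun i => v (σ (Fin.natAdd k i))) +
            ∑ i, D (Function.update (fun i => v (σ (Fin.natAdd k i))) i
              (c (σ (Fin.natAdd k i)) ν • e + ∑ μ, H (σ (Fin.natAdd k i)) ν μ • dx μ))) • dx ν)) =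
      -(((Equiv.Perm.sign σ : ℤ) : ℝ) *
          (D.curryLeft e (fun i => v (σ (Fin.castAdd (k + 1) i))) *
            D (fun i => v (σ (Fin.natAdd k i))))) -
        (∑ ν, ((Equiv.Perm.sign σ : ℤ) : ℝ) *
          (D.curryLeft (dx ν) (fun i => v (σ (Fin.castAdd (k + 1) i))) *
            D' ν (fun i => v (σ (Fin.natAdd k i))))) -
        ((Equiv.Perm.sign σ : ℤ) : ℝ) *
          ∑ ν, D.curryLeft (dx ν) (fun i => v (σ (Fin.castAdd (k + 1) i))) *
            ∑ i, D (Function.update (fun i => v (σ (Fin.natAdd k i))) i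
              (c (σ (Fin.natAdd k i)) ν • e + ∑ μ, H (σ (Fin.natAdd k i)) ν μ • dx μ)) := by
    intro σ
    rw [hsnoc]
    simp only [mul_add, Finset.sum_add_distrib, ← Finset.mul_sum]
    ring
  rw [Finset.sum_congr rfl fun σ _ => hσ σ]
  simp only [Finset.sum_sub_distrib, Finset.sum_neg_distrib]
  rw [hT, ← factorial_mul_wedge_apply, Finset.sum_comm]
  simp only [← factorial_mul_wedge_apply, ← Finset.mul_sum]
  ring

end JacobiSum

/-! ### Forms on ℝ × W and odd-degree identities -/

section Suspension

variable {W : Type*} [AddCommGroup W] [Module ℝ W]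

theorem wedge_smul_left {a b : ℕ} (c : ℝ) (P : W [⋀^Fin a]→ₗ[ℝ] ℝ) (Q : W [⋀^Fin b]→ₗ[ℝ] ℝ) :
    wedge (c • P) Q = c • wedge P Q := by
  ext v
  have h0 : ((a.factorial * b.factorial : ℕ) : ℝ) ≠ 0 :=
    Nat.cast_ne_zero.2 (Nat.mul_ne_zero a.factorial_ne_zero b.factorial_ne_zero)
  refine mul_left_cancel₀ h0 ?_
  rw [AlternatingMap.smul_apply, smul_eq_mul, mul_left_comm, factorial_mul_wedge_apply,
    factorial_mul_wedge_apply, Finset.mul_sum]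
  refine Finset.sum_congr rfl fun σ _ => ?_
  rw [AlternatingMap.smul_apply, smul_eq_mul]
  ring

theorem zero_wedge {a b : ℕ} (Q : W [⋀^Fin b]→ₗ[ℝ] ℝ) :
    wedge (0 : W [⋀^Fin a]→ₗ[ℝ] ℝ) Q = 0 := by
  simpa using wedge_smul_left 0 (0 : W [⋀^Fin a]→ₗ[ℝ] ℝ) Q

theorem wedge_self_of_odd {k : ℕ} (hk : Odd k) (P : W [⋀^Fin k]→ₗ[ℝ] ℝ) : wedge P P = 0 := by
  have h := wedge_comm P P
  rw [(hk.mul hk).neg_one_pow] at h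
  ext v
  have h' := congrArg (fun f => f v) h
  simp only [finCongr_refl, AlternatingMap.domDomCongr_apply, AlternatingMap.smul_apply] at h'
  have h'' : wedge P P v = -1 * wedge P P v := h'
  simp only [AlternatingMap.zero_apply]
  linarith

/-- Polarisation of the fact that contracting twice with the same vector gives zero. -/
theorem curryLeft_curryLeft_swap {k : ℕ} (D : W [⋀^Fin (k + 2)]→ₗ[ℝ] ℝ) (u u' : W) :
    (D.curryLeft u).curryLeft u' = -(D.curryLeft u').curryLeft u := by
  have h := D.curryLeft_same (u + u')
  simp only [map_add, AlternatingMap.curryLeft_add, LinearMap.add_apply] at h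
  have h1 := D.curryLeft_same u
  have h2 := D.curryLeft_same u'
  simp [h1, h2] at h
  exact eq_neg_of_add_eq_zero_right h

/-- An alternating form on `ℝ × W` vanishes as soon as it and its contraction with `(1, 0)`
vanish on `W`. -/
theorem alternatingMap_prod_eq_zero [Module.Finite ℝ W] {N : ℕ}
    (η : (ℝ × W) [⋀^Fin (N + 1)]→ₗ[ℝ] ℝ)
    (h0 : ∀ β : Fin (N + 1) → W, η (fun i => (0, β i)) = 0)
    (h1 : ∀ β : Fin N → W, η (Fin.cons (1, 0) fun i => (0, β i)) = 0) : η = 0 := by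
  -- An alternating form is tested on families of distinct basis vectors, and in this basis at most
  -- one of them can be (1, 0). If it occurs, it is moved to the front at the cost of a sign.
  let b := (Module.Basis.singleton Unit ℝ).prod (Module.finBasis ℝ W)
  refine Module.Basis.ext_alternating b fun v hv => ?_
  have hinr : ∀ l, b (Sum.inr l) = (0, Module.finBasis ℝ W l) := fun l => by simp [b]
  have hinl : ∀ l, b (Sum.inl l) = (1, 0) := fun l => by simp [b]
  by_cases h : ∃ p, (v p).isLeft
  · obtain ⟨p, hp⟩ := h
    obtain ⟨l, hl⟩ := Sum.isLeft_iff.1 hp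
    have hr : ∀ i, ∃ j, v (p.succAbove i) = Sum.inr j := fun i => by
      rcases hvi : v (p.succAbove i) with l' | j
      · exact absurd (hv (hvi.trans hl.symm)) (Fin.succAbove_ne p i)
      · exact ⟨j, rfl⟩
    choose j hj using hr
    have hins : (fun i => b (v i)) =
        Fin.insertNth p ((1, 0) : ℝ × W) fun i => (0, Module.finBasis ℝ W (j i)) := by
      refine (Fin.eq_insertNth_iff).2 ⟨?_, ?_⟩
      · rw [hl, hinl]
      · funext i
        simp only [Fin.removeNth]
        rw [hj, hinr]
    rw [hins, η.map_insertNth]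
    have := h1 fun i => Module.finBasis ℝ W (j i)
    simp only [AlternatingMap.zero_apply]
    exact smul_eq_zero_of_right _ this
  · push Not at h
    have hr : ∀ i, ∃ j, v i = Sum.inr j := fun i => Sum.isRight_iff.1 (by simpa using h i)
    choose j hj using hr
    simp only [hj, hinr, AlternatingMap.zero_apply]
    exact h0 _

end Suspension

/-! ### The form on 1-jets attached to (Λ, E) -/

section JetForm

variable {V : Type*} [NormedAddCommGroup V] [NormedSpace ℝ V]

/-- The alternating form on `1`-jets `(f, df)` given by
`Λ(df₁, …, df_{k+1}) + ∑_j (-1)^j f_j E(df₁, …, omit df_j, …, df_{k+1})`. -/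
noncomputable def jetForm (V : Type*) [NormedAddCommGroup V] [NormedSpace ℝ V] (k : ℕ) :
    (V [⋀^Fin (k + 1)]→L[ℝ] ℝ) × (V [⋀^Fin k]→L[ℝ] ℝ) →L[ℝ]
      (ℝ × V) [⋀^Fin (k + 1)]→L[ℝ] ℝ :=
  (ContinuousAlternatingMap.compContinuousLinearMapCLM (ContinuousLinearMap.snd ℝ ℝ V)).comp
      (ContinuousLinearMap.fst ℝ _ _) +
    ((ContinuousAlternatingMap.alternatizeUncurryFinCLM ℝ (ℝ × V) ℝ).comp
      ((ContinuousLinearMap.smulRightL ℝ (ℝ × V) _ (ContinuousLinearMap.fst ℝ ℝ V)).comp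
        (ContinuousAlternatingMap.compContinuousLinearMapCLM
          (ContinuousLinearMap.snd ℝ ℝ V)))).comp (ContinuousLinearMap.snd ℝ _ _)

theorem jetForm_apply {k : ℕ} (L : V [⋀^Fin (k + 1)]→L[ℝ] ℝ) (E : V [⋀^Fin k]→L[ℝ] ℝ)
    (v : Fin (k + 1) → ℝ × V) :
    jetForm V k (L, E) v = L (fun i => (v i).2) +
      ∑ j : Fin (k + 1), (-1 : ℝ) ^ (j : ℕ) * ((v j).1 * E (fun i => (v (j.succAbove i)).2)) := by
  simp [jetForm, ContinuousAlternatingMap.alternatizeUncurryFin_apply]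
  rfl

end JetForm

theorem alternatingMap_sum_apply {ι W : Type*} [AddCommGroup W] [Module ℝ W] {k : ℕ}
    (s : Finset ι) (f : ι → W [⋀^Fin k]→ₗ[ℝ] ℝ) (v : Fin k → W) :
    (∑ i ∈ s, f i) v = ∑ i ∈ s, f i v := by
  classical
  induction s using Finset.induction_on with
  | empty => simp
  | insert i s hi ih => simp [Finset.sum_insert hi, ih]

section JetFormAlgebra

variable {V : Type*} [NormedAddCommGroup V] [NormedSpace ℝ V]

theorem jetForm_apply_inr {k : ℕ} (L : V [⋀^Fin (k + 1)]→L[ℝ] ℝ) (E : V [⋀^Fin k]→L[ℝ] ℝ)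
    (β : Fin (k + 1) → V) : jetForm V k (L, E) (fun i => (0, β i)) = L β := by
  simp [jetForm_apply]

theorem jetForm_compLinearMap_inr {k : ℕ} (L : V [⋀^Fin (k + 1)]→L[ℝ] ℝ)
    (E : V [⋀^Fin k]→L[ℝ] ℝ) :
    (jetForm V k (L, E)).toAlternatingMap.compLinearMap (LinearMap.inr ℝ ℝ V) =
      L.toAlternatingMap := by
  ext β
  exact jetForm_apply_inr L E β

/-- The vector (1, 0) has zero covector part, so every term that feeds it to Λ or E vanishes; only j
= 0 survives. -/
theorem jetForm_curryLeft_one {k : ℕ} (L : V [⋀^Fin (k + 1)]→L[ℝ] ℝ) (E : V [⋀^Fin k]→L[ℝ] ℝ) :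
    (jetForm V k (L, E)).toAlternatingMap.curryLeft (1, 0) =
      E.toAlternatingMap.compLinearMap (LinearMap.snd ℝ ℝ V) := by
  ext w
  refine (jetForm_apply L E (Fin.cons (1, 0) w)).trans ?_
  have hL : L (fun i => ((Fin.cons (1, 0) w : Fin (k + 1) → ℝ × V) i).2) = 0 :=
    L.toMultilinearMap.map_coord_zero 0 (by simp)
  rw [hL]
  have hz : ∀ j : Fin k, E (fun i => ((Fin.cons (1, 0) w : Fin (k + 1) → ℝ × V)
      (j.succ.succAbove i)).2) = 0 := fun j => by
    obtain _ | k := k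
    · exact j.elim0
    · exact E.toMultilinearMap.map_coord_zero 0 (by simp)
  rw [Fin.sum_univ_succ]
  simp [hz]

theorem curryLeft_compLinearMap_inr {k : ℕ} (D : (ℝ × V) [⋀^Fin (k + 1)]→ₗ[ℝ] ℝ) (α : V) :
    (D.curryLeft (0, α)).compLinearMap (LinearMap.inr ℝ ℝ V) =
      (D.compLinearMap (LinearMap.inr ℝ ℝ V)).curryLeft α :=
  (AlternatingMap.curryLeft_compLinearMap (LinearMap.inr ℝ ℝ V) D α).symm

theorem compLinearMap_snd_inr {k : ℕ} (P : V [⋀^Fin k]→ₗ[ℝ] ℝ) :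
    (P.compLinearMap (LinearMap.snd ℝ ℝ V)).compLinearMap (LinearMap.inr ℝ ℝ V) = P := by
  ext β
  rfl

theorem wedge_apply_inr {a b : ℕ} (P : (ℝ × V) [⋀^Fin a]→ₗ[ℝ] ℝ) (Q : (ℝ × V) [⋀^Fin b]→ₗ[ℝ] ℝ)
    (β : Fin (a + b) → V) :
    wedge P Q (fun i => (0, β i)) = wedge (P.compLinearMap (LinearMap.inr ℝ ℝ V))
      (Q.compLinearMap (LinearMap.inr ℝ ℝ V)) β := by
  rw [← wedge_compLinearMap]
  rfl

/-- The vanishing of the first-order part of the generalized Jacobi identity, split into its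
components. -/
theorem jetForm_jacobi_iff [FiniteDimensional ℝ V] {n m : ℕ} (hm : Odd (m + 1))
    (L : V [⋀^Fin (m + 2)]→L[ℝ] ℝ) (E : V [⋀^Fin (m + 1)]→L[ℝ] ℝ)
    (L' : Fin n → V [⋀^Fin (m + 2)]→L[ℝ] ℝ) (E' : Fin n → V [⋀^Fin (m + 1)]→L[ℝ] ℝ)
    (dx : Fin n → V) :
    (∀ v : Fin (m + 1 + (m + 1 + 1)) → ℝ × V,
      ((m + 1 : ℕ) : ℝ) * wedge ((jetForm V (m + 1) (L, E)).toAlternatingMap.curryLeft (1, 0))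
        (jetForm V (m + 1) (L, E)).toAlternatingMap v -
      ∑ ν, wedge ((jetForm V (m + 1) (L, E)).toAlternatingMap.curryLeft (0, dx ν))
        (jetForm V (m + 1) (L' ν, E' ν)).toAlternatingMap v = 0) ↔
    (∀ β : Fin (m + 1 + (m + 1 + 1)) → V,
      ∑ ν, wedge (L.toAlternatingMap.curryLeft (dx ν)) (L' ν).toAlternatingMap β =
        ((m + 1 : ℕ) : ℝ) * wedge E.toAlternatingMap L.toAlternatingMap β) ∧
    (∀ β : Fin (m + 1 + (m + 1)) → V,
      ∑ ν, (wedge (E.toAlternatingMap.curryLeft (dx ν)) (L' ν).toAlternatingMap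
          (fun i => β (i.cast (by omega))) +
        wedge (L.toAlternatingMap.curryLeft (dx ν)) (E' ν).toAlternatingMap β) = 0) := by
  set D := (jetForm V (m + 1) (L, E)).toAlternatingMap with hD
  let D' : Fin n → (ℝ × V) [⋀^Fin (m + 1 + 1)]→ₗ[ℝ] ℝ :=
    fun ν => (jetForm V (m + 1) (L' ν, E' ν)).toAlternatingMap
  -- Collecting both terms into one alternating form allows its vanishing to be tested on covectors
  -- and on the contraction with (1, 0).
  let η : (ℝ × V) [⋀^Fin (m + 1 + (m + 1) + 1)]→ₗ[ℝ] ℝ :=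
    ((m + 1 : ℕ) : ℝ) • wedge (D.curryLeft (1, 0)) D - ∑ ν, wedge (D.curryLeft (0, dx ν)) (D' ν)
  have hη : ∀ v, η v = ((m + 1 : ℕ) : ℝ) * wedge (D.curryLeft (1, 0)) D v -
      ∑ ν, wedge (D.curryLeft (0, dx ν)) (D' ν) v := fun v => by
    simp only [η, AlternatingMap.sub_apply, AlternatingMap.smul_apply, smul_eq_mul]
    congr 1
    exact alternatingMap_sum_apply _ _ _
  have hDinr : D.compLinearMap (LinearMap.inr ℝ ℝ V) = L.toAlternatingMap :=
    jetForm_compLinearMap_inr L E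
  have hD'inr : ∀ ν, (D' ν).compLinearMap (LinearMap.inr ℝ ℝ V) = (L' ν).toAlternatingMap :=
    fun ν => jetForm_compLinearMap_inr _ _
  have hDone : D.curryLeft (1, 0) = E.toAlternatingMap.compLinearMap (LinearMap.snd ℝ ℝ V) :=
    jetForm_curryLeft_one L E
  have hD'one : ∀ ν, (D' ν).curryLeft (1, 0) =
      (E' ν).toAlternatingMap.compLinearMap (LinearMap.snd ℝ ℝ V) :=
    fun ν => jetForm_curryLeft_one _ _
  have h0 : ∀ β : Fin (m + 1 + (m + 1) + 1) → V, η (fun i => (0, β i)) =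
      ((m + 1 : ℕ) : ℝ) * wedge E.toAlternatingMap L.toAlternatingMap β -
        ∑ ν, wedge (L.toAlternatingMap.curryLeft (dx ν)) (L' ν).toAlternatingMap β := fun β => by
    rw [hη, hDone]
    congr 1
    · refine congrArg _ ((wedge_apply_inr _ _ _).trans ?_)
      rw [compLinearMap_snd_inr, hDinr]
    · refine Finset.sum_congr rfl fun ν _ => (wedge_apply_inr _ _ _).trans ?_
      rw [curryLeft_compLinearMap_inr, hDinr, hD'inr]
  have h1 : ∀ β : Fin (m + 1 + (m + 1)) → V, η (Fin.cons (1, 0) fun i => (0, β i)) =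
      ∑ ν, (wedge (E.toAlternatingMap.curryLeft (dx ν)) (L' ν).toAlternatingMap
          (fun i => β (i.cast (by omega))) +
        wedge (L.toAlternatingMap.curryLeft (dx ν)) (E' ν).toAlternatingMap β) := fun β => by
    -- With e = (1, 0), the contraction is ι_e ι_e D ∧ D - ι_e D ∧ ι_e D: the first term vanishes by
    -- alternation, the second because ι_e D has odd degree.
    have e1 : wedge (D.curryLeft (1, 0)) D (Fin.cons (1, 0) fun i => (0, β i) :
        Fin (m + 1 + (m + 1) + 1) → ℝ × V) = 0 := by
      refine (wedge_cons (D.curryLeft (1, 0)) D (1, 0) fun i => (0, β i)).trans ?_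
      rw [AlternatingMap.curryLeft_same, zero_wedge, wedge_self_of_odd hm]
      simp
    -- Both summands acquire a minus sign: one from anticommuting the two contractions, the other
    -- from passing a form of odd degree.
    have e2 : ∀ ν, wedge (D.curryLeft (0, dx ν)) (D' ν) (Fin.cons (1, 0) fun i => (0, β i) :
        Fin (m + 1 + (m + 1) + 1) → ℝ × V) =
        -(wedge (E.toAlternatingMap.curryLeft (dx ν)) (L' ν).toAlternatingMap
          (fun i => β (i.cast (by omega))) +
        wedge (L.toAlternatingMap.curryLeft (dx ν)) (E' ν).toAlternatingMap β) := fun ν => by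
      refine (wedge_cons (D.curryLeft (0, dx ν)) (D' ν) (1, 0) fun i => (0, β i)).trans ?_
      rw [curryLeft_curryLeft_swap, hDone, hD'one, ← neg_one_smul ℝ, wedge_smul_left,
        hm.neg_one_pow, AlternatingMap.smul_apply, wedge_apply_inr, wedge_apply_inr,
        AlternatingMap.curryLeft_compLinearMap, compLinearMap_snd_inr, compLinearMap_snd_inr,
        curryLeft_compLinearMap_inr, hDinr, hD'inr]
      simp only [LinearMap.snd_apply, smul_eq_mul]
      ring
    rw [hη]
    refine (congrArg₂ (· - ·) (congrArg _ e1) (Finset.sum_congr rfl fun ν _ => e2 ν)).trans ?_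
    rw [Finset.sum_neg_distrib]
    simp
  have hiff : (∀ v, η v = 0) ↔ (∀ β : Fin (m + 1 + (m + 1) + 1) → V, η (fun i => (0, β i)) = 0) ∧
      ∀ β : Fin (m + 1 + (m + 1)) → V, η (Fin.cons (1, 0) fun i => (0, β i)) = 0 := by
    refine ⟨fun h => ⟨fun β => h _, fun β => h _⟩, fun h v => ?_⟩
    rw [alternatingMap_prod_eq_zero η h.1 h.2]
    rfl
  simp only [h0, h1, sub_eq_zero] at hiff
  refine (forall_congr' fun v => by rw [← hη]).trans (hiff.trans (and_congr ?_ Iff.rfl))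
  exact forall_congr' fun β => eq_comm

end JetFormAlgebra

/-! ### The Schouten bracket in coordinates -/

section Coordinates

variable {n : ℕ}

theorem coordSchouten_apply {a b : ℕ} (P : CoordSpace n → CoordDual n [⋀^Fin (a + 1)]→L[ℝ] ℝ)
    (Q : CoordSpace n → CoordDual n [⋀^Fin (b + 1)]→L[ℝ] ℝ) (y : CoordSpace n)
    (β : Fin (a + b + 1) → CoordDual n) :
    coordSchouten P Q y β = ∑ ν : Fin n,
      (wedge (contract P ν y) (partialDeriv Q ν y) (fun i => β (i.cast (by omega))) +
        (-1 : ℝ) ^ (a + 1) *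
          wedge (partialDeriv P ν y) (contract Q ν y) (fun i => β (i.cast (by omega)))) :=
  alternatingMap_sum_apply _ _ _

theorem wedge_comm_apply {W : Type*} [AddCommGroup W] [Module ℝ W] {a b : ℕ}
    (P : W [⋀^Fin a]→ₗ[ℝ] ℝ) (Q : W [⋀^Fin b]→ₗ[ℝ] ℝ) (v : Fin (b + a) → W) :
    wedge Q P v = (-1 : ℝ) ^ (a * b) * wedge P Q (fun i => v (i.cast (by omega))) := by
  have h : wedge P Q (fun i => v (i.cast (by omega))) = (-1 : ℝ) ^ (a * b) * wedge Q P v :=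
    congrArg (fun f => f v) (wedge_comm P Q)
  rw [h, ← mul_assoc, ← mul_pow]
  simp

/-- The two equations of the characterization in coordinates. -/
theorem coordSchouten_iff {m : ℕ} (hm : Odd (m + 1))
    (P : CoordSpace n → CoordDual n [⋀^Fin (m + 2)]→L[ℝ] ℝ)
    (Q : CoordSpace n → CoordDual n [⋀^Fin (m + 1)]→L[ℝ] ℝ) (y : CoordSpace n) :
    ((∀ β : Fin (m + 1 + (m + 1 + 1)) → CoordDual n,
      ∑ ν, wedge (contract P ν y) (partialDeriv P ν y) β =
        ((m + 1 : ℕ) : ℝ) * wedge (Q y).toAlternatingMap (P y).toAlternatingMap β) ∧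
    (∀ β : Fin (m + 1 + (m + 1)) → CoordDual n,
      ∑ ν, (wedge (contract Q ν y) (partialDeriv P ν y) (fun i => β (i.cast (by omega))) +
        wedge (contract P ν y) (partialDeriv Q ν y) β) = 0)) ↔
    coordSchouten P P y =
      (2 * ((m + 1 : ℕ) : ℝ)) • wedge (Q y).toAlternatingMap (P y).toAlternatingMap ∧
    coordSchouten Q P y = 0 := by
  refine and_congr ?_ ?_
  -- The two halves of [P, P] agree: P has even degree m + 2, and commuting factors of degrees m + 1
  -- and m + 2 costs no sign. Hence the factor 2.
  · have h : ∀ β : Fin (m + 1 + (m + 1) + 1) → CoordDual n, coordSchouten P P y β =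
        2 * ∑ ν, wedge (contract P ν y) (partialDeriv P ν y) β := fun β => by
      rw [coordSchouten_apply, Finset.mul_sum]
      refine Finset.sum_congr rfl fun ν _ => ?_
      rw [wedge_comm_apply (contract P ν y) (partialDeriv P ν y), hm.add_one.neg_one_pow,
        (Nat.even_mul_succ_self (m + 1)).neg_one_pow, one_mul, one_mul, two_mul]
      rfl
    rw [AlternatingMap.ext_iff]
    refine forall_congr' fun β => ?_
    rw [h, AlternatingMap.smul_apply, smul_eq_mul, mul_assoc]
    exact (mul_right_inj' two_ne_zero).symm
  -- The sign (-1)^(m+1) = -1 of the bracket cancels the sign from commuting two factors of odd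
  -- degree m + 1.
  · have h : ∀ β : Fin (m + 1 + (m + 1)) → CoordDual n,
        coordSchouten Q P y (fun i => β (i.cast (by omega))) =
        ∑ ν, (wedge (contract Q ν y) (partialDeriv P ν y) (fun i => β (i.cast (by omega))) +
          wedge (contract P ν y) (partialDeriv Q ν y) β) := fun β => by
      rw [coordSchouten_apply]
      refine Finset.sum_congr rfl fun ν _ => ?_
      rw [wedge_comm_apply (contract P ν y) (partialDeriv Q ν y), hm.neg_one_pow,
        (hm.mul hm).neg_one_pow, ← mul_assoc]
      simp
    constructor
    · intro h'
      ext β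
      let β' : Fin (m + 1 + (m + 1)) → CoordDual n := fun i => β (Fin.cast (by omega) i)
      have hβ : (fun i : Fin (m + (m + 1) + 1) => β' (Fin.cast (by omega) i)) = β := by
        funext i
        rfl
      rw [← hβ]
      exact (h β').trans (h' β')
    · intro h' β
      rw [← h, h']
      rfl

end Coordinates

/-- Leibniz rule: the value is linear in the coefficients and multilinear in the jets. -/
theorem fderiv_jetForm_apply {X V : Type*} [NormedAddCommGroup X] [NormedSpace ℝ X]
    [NormedAddCommGroup V] [NormedSpace ℝ V] {k : ℕ} {L : X → V [⋀^Fin (k + 1)]→L[ℝ] ℝ}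
    {E : X → V [⋀^Fin k]→L[ℝ] ℝ} {j : Fin (k + 1) → X → ℝ × V} {j' : Fin (k + 1) → X →L[ℝ] ℝ × V}
    {y : X} (hL : DifferentiableAt ℝ L y) (hE : DifferentiableAt ℝ E y)
    (hj : ∀ i, HasFDerivAt (j i) (j' i) y) (u : X) :
    fderiv ℝ (fun y => jetForm V k (L y, E y) (fun i => j i y)) y u =
      jetForm V k (fderiv ℝ L y u, fderiv ℝ E y u) (fun i => j i y) +
      ∑ i, jetForm V k (L y, E y) (Function.update (fun i => j i y) i (j' i u)) := by
  have hD : HasFDerivAt (fun y => ContinuousAlternatingMap.toContinuousMultilinearMapCLM ℝ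
      (jetForm V k (L y, E y)))
      (((ContinuousAlternatingMap.toContinuousMultilinearMapCLM ℝ).comp
        (jetForm V k)).comp ((fderiv ℝ L y).prod (fderiv ℝ E y))) y :=
    ((ContinuousAlternatingMap.toContinuousMultilinearMapCLM ℝ).comp
      (jetForm V k)).hasFDerivAt.comp y (hL.hasFDerivAt.prodMk hE.hasFDerivAt)
  have h := hD.continuousMultilinearMap_apply hj
  have h' := congrArg (fun φ => φ u) h.fderiv
  refine Eq.trans ?_ (h'.trans ?_)
  · rfl
  · simp

/-! ### Jets of functions and the Jacobi sum on ℝⁿ -/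

section CoordinateJets

variable {n : ℕ}

/-- The `1`-jet `(f(y), df(y))` of a function on `ℝⁿ`. -/
noncomputable def coordJet (F : CoordSpace n → ℝ) (y : CoordSpace n) : ℝ × CoordDual n :=
  (F y, fderiv ℝ F y)

theorem coordDual_eq_sum (α : CoordDual n) :
    α = ∑ ν, α (coordVector ν) • coordCovector ν := by
  ext x
  conv_lhs => rw [← (EuclideanSpace.basisFun (Fin n) ℝ).sum_repr x, map_sum]
  simp [coordVector, coordCovector, mul_comm]

theorem prod_coordDual_eq_sum (a : ℝ) (α : CoordDual n) :
    (a, α) = a • ((1, 0) : ℝ × CoordDual n) +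
      ∑ ν, α (coordVector ν) • ((0, coordCovector ν) : ℝ × CoordDual n) := by
  refine Prod.ext ?_ ?_
  · simp [Prod.fst_sum]
  · simp only [Prod.snd_add, Prod.smul_snd, smul_zero, Prod.snd_sum, zero_add]
    exact coordDual_eq_sum α

theorem coordJet_eq_sum (F : CoordSpace n → ℝ) (y : CoordSpace n) :
    coordJet F y = F y • ((1, 0) : ℝ × CoordDual n) +
      ∑ ν, fderiv ℝ F y (coordVector ν) • ((0, coordCovector ν) : ℝ × CoordDual n) :=
  prod_coordDual_eq_sum _ _

theorem hasFDerivAt_coordJet {F : CoordSpace n → ℝ} {y : CoordSpace n}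
    (hF : ContDiffAt ℝ ∞ F y) :
    HasFDerivAt (coordJet F) ((fderiv ℝ F y).prod (fderiv ℝ (fderiv ℝ F) y)) y :=
  (hF.differentiableAt (by simp)).hasFDerivAt.prodMk
    ((hF.fderiv_right (m := ∞) (by simp)).differentiableAt (by simp)).hasFDerivAt

/-- The bracket of functions on `ℝⁿ` attached to the components of `Λ` and `E`. -/
noncomputable def coordBracket {k : ℕ} (L : CoordSpace n → CoordDual n [⋀^Fin (k + 1)]→L[ℝ] ℝ)
    (E : CoordSpace n → CoordDual n [⋀^Fin k]→L[ℝ] ℝ) (F : Fin (k + 1) → CoordSpace n → ℝ)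
    (y : CoordSpace n) : ℝ :=
  jetForm (CoordDual n) k (L y, E y) (fun i => coordJet (F i) y)

theorem fderiv_coordBracket {k : ℕ} {L : CoordSpace n → CoordDual n [⋀^Fin (k + 1)]→L[ℝ] ℝ}
    {E : CoordSpace n → CoordDual n [⋀^Fin k]→L[ℝ] ℝ} {F : Fin (k + 1) → CoordSpace n → ℝ}
    {y : CoordSpace n} (hL : DifferentiableAt ℝ L y) (hE : DifferentiableAt ℝ E y)
    (hF : ∀ i, ContDiffAt ℝ ∞ (F i) y) (u : CoordSpace n) :
    fderiv ℝ (coordBracket L E F) y u =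
      jetForm (CoordDual n) k (fderiv ℝ L y u, fderiv ℝ E y u) (fun i => coordJet (F i) y) +
      ∑ i, jetForm (CoordDual n) k (L y, E y) (Function.update (fun i => coordJet (F i) y) i
        (fderiv ℝ (F i) y u, fderiv ℝ (fderiv ℝ (F i)) y u)) :=
  fderiv_jetForm_apply (V := CoordDual n) (L := L) (E := E) hL hE
    (fun i => hasFDerivAt_coordJet (hF i)) u

/-- The jet of the inner bracket, expanded by the Leibniz rule, has exactly the shape required by
`jacobi_sum_eq`; the symmetry of H is that of second derivatives. -/
theorem coord_jacobi_sum {m : ℕ} (hm : Odd (m + 1))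
    {L : CoordSpace n → CoordDual n [⋀^Fin (m + 2)]→L[ℝ] ℝ}
    {E : CoordSpace n → CoordDual n [⋀^Fin (m + 1)]→L[ℝ] ℝ} {y : CoordSpace n}
    (hL : DifferentiableAt ℝ L y) (hE : DifferentiableAt ℝ E y)
    (F : Fin (m + 1 + (m + 1 + 1)) → CoordSpace n → ℝ) (hF : ∀ i, ContDiffAt ℝ ∞ (F i) y) :
    ∑ σ : Equiv.Perm (Fin (m + 1 + (m + 1 + 1))), ((Equiv.Perm.sign σ : ℤ) : ℝ) *
      coordBracket L E (Fin.snoc (α := fun _ => CoordSpace n → ℝ)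
        (fun i => F (σ (Fin.castAdd (m + 1 + 1) i)))
        (coordBracket L E fun i => F (σ (Fin.natAdd (m + 1) i)))) y =
    (((m + 1).factorial * (m + 1 + 1).factorial : ℕ) : ℝ) *
      (((m + 1 : ℕ) : ℝ) * wedge ((jetForm (CoordDual n) (m + 1)
          (L y, E y)).toAlternatingMap.curryLeft (1, 0))
        (jetForm (CoordDual n) (m + 1) (L y, E y)).toAlternatingMap (fun i => coordJet (F i) y) -
      ∑ ν, wedge ((jetForm (CoordDual n) (m + 1)
          (L y, E y)).toAlternatingMap.curryLeft (0, coordCovector ν))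
        (jetForm (CoordDual n) (m + 1) (fderiv ℝ L y (coordVector ν),
          fderiv ℝ E y (coordVector ν))).toAlternatingMap (fun i => coordJet (F i) y)) := by
  rw [← jacobi_sum_eq hm (jetForm (CoordDual n) (m + 1) (L y, E y)).toAlternatingMap
    (fun ν => (jetForm (CoordDual n) (m + 1) (fderiv ℝ L y (coordVector ν),
          fderiv ℝ E y (coordVector ν))).toAlternatingMap) (1, 0)
    (fun ν => (0, coordCovector ν)) (fun i => coordJet (F i) y) (fun i => F i y)
    (fun i ν => fderiv ℝ (F i) y (coordVector ν))
    (fun i ν μ => fderiv ℝ (fderiv ℝ (F i)) y (coordVector ν) (coordVector μ))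
    (fun i => coordJet_eq_sum _ _)
    (fun i ν μ => ((hF i).isSymmSndFDerivAt (by
      simpa using (ENat.LEInfty.out : (2 : WithTop ℕ∞) ≤ ∞))) _ _)]
  refine Finset.sum_congr rfl fun σ _ => congrArg _ ?_
  have hsnoc : (fun i => coordJet (Fin.snoc (α := fun _ => CoordSpace n → ℝ)
      (fun i => F (σ (Fin.castAdd (m + 1 + 1) i)))
      (coordBracket L E fun i => F (σ (Fin.natAdd (m + 1) i))) i) y) =
      Fin.snoc (α := fun _ => ℝ × CoordDual n)
        (fun i => coordJet (F (σ (Fin.castAdd (m + 1 + 1) i))) y)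
        (coordJet (coordBracket L E fun i => F (σ (Fin.natAdd (m + 1) i))) y) := by
    funext i
    refine Fin.lastCases ?_ (fun i => ?_) i
    · simp
    · simp
  refine (congrArg (jetForm (CoordDual n) (m + 1) (L y, E y)) hsnoc).trans ?_
  rw [coordJet_eq_sum (coordBracket L E _)]
  simp only [fderiv_coordBracket hL hE fun i => hF (σ (Fin.natAdd (m + 1) i)), ←
    prod_coordDual_eq_sum]
  rfl

end CoordinateJets

theorem compLinearMap_eq_smul_iff {V W : Type*} [AddCommGroup V] [Module ℝ V] [AddCommGroup W]
    [Module ℝ W] {N : ℕ} {f : V →ₗ[ℝ] W} (hf : Function.Surjective f)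
    (S T : W [⋀^Fin N]→ₗ[ℝ] ℝ) (c : ℝ) :
    S.compLinearMap f = c • T.compLinearMap f ↔ S = c • T :=
  (AlternatingMap.compLinearMap_injective f hf).eq_iff (b := c • T)

theorem compLinearMap_eq_zero_iff {V W : Type*} [AddCommGroup V] [Module ℝ V] [AddCommGroup W]
    [Module ℝ W] {N : ℕ} {f : V →ₗ[ℝ] W} (hf : Function.Surjective f)
    (S : W [⋀^Fin N]→ₗ[ℝ] ℝ) : S.compLinearMap f = 0 ↔ S = 0 :=
  (AlternatingMap.compLinearMap_injective f hf).eq_iff (b := 0)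

/-! ### Transfer between the manifold and a chart -/

section ManifoldJets

variable {n : ℕ} {M : Type*} [TopologicalSpace M] [ChartedSpace (EuclideanSpace ℝ (Fin n)) M]
  [IsManifold (𝓡 n) ∞ M]

/-- The bracket sees only 1-jets. This is needed because the inner bracket equals its chart
expression only on the chart target. -/
theorem coordBracket_congr {k : ℕ} (L : CoordSpace n → CoordDual n [⋀^Fin (k + 1)]→L[ℝ] ℝ)
    (E : CoordSpace n → CoordDual n [⋀^Fin k]→L[ℝ] ℝ) {F G : Fin (k + 1) → CoordSpace n → ℝ}
    {y : CoordSpace n} (h : ∀ i, F i =ᶠ[nhds y] G i) :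
    coordBracket L E F y = coordBracket L E G y := by
  unfold coordBracket
  congr 1
  funext i
  exact Prod.ext (h i).eq_of_nhds (h i).fderiv_eq

theorem coordRep_apply_fderiv {k : ℕ} (P : MultivectorField n M k) (f : Fin k → M → ℝ)
    (hf : ∀ i, ContMDiff (𝓡 n) 𝓘(ℝ, ℝ) ∞ (f i)) (x₀ : M) {y : CoordSpace n}
    (hy : y ∈ (extChartAt (𝓡 n) x₀).target) :
    coordRep n P.toFun x₀ y (fun i => fderiv ℝ (f i ∘ (extChartAt (𝓡 n) x₀).symm) y) =
      P.toFun ((extChartAt (𝓡 n) x₀).symm y)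
        (fun i => differential (f i) ((extChartAt (𝓡 n) x₀).symm y)) := by
  refine congrArg (P.toFun ((extChartAt (𝓡 n) x₀).symm y)) (funext fun i => ?_)
  have h := chartPullback_differential (hf i) x₀ ((extChartAt (𝓡 n) x₀).map_target hy)
  rw [(extChartAt (𝓡 n) x₀).right_inv hy] at h
  exact h

theorem genJacobiBracket_symm_apply {k : ℕ} (Λ : MultivectorField n M (k + 1))
    (E : MultivectorField n M k) (f : Fin (k + 1) → C^∞⟮𝓡 n, M; 𝓘(ℝ, ℝ), ℝ⟯) (x₀ : M)
    {y : CoordSpace n} (hy : y ∈ (extChartAt (𝓡 n) x₀).target) :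
    genJacobiBracket Λ E f ((extChartAt (𝓡 n) x₀).symm y) =
      coordBracket (coordRep n Λ.toFun x₀) (coordRep n E.toFun x₀)
        (fun i => f i ∘ (extChartAt (𝓡 n) x₀).symm) y := by
  unfold coordBracket
  rw [jetForm_apply]
  change Λ.toFun _ _ - ∑ j, _ = _
  rw [← coordRep_apply_fderiv Λ (fun i => f i) (fun i => (f i).contMDiff) x₀ hy, sub_eq_add_neg,
    ← Finset.sum_neg_distrib]
  refine congrArg₂ (· + ·) rfl (Finset.sum_congr rfl fun j _ => ?_)
  rw [← coordRep_apply_fderiv E (fun i => f (j.succAbove i)) (fun i => (f _).contMDiff) x₀ hy,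
    pow_succ]
  simp only [coordJet, Function.comp_apply]
  ring

/-- The left-hand side of the generalized Jacobi identity in a chart. -/
theorem jacobi_sum_apply {k : ℕ} (Λ : MultivectorField n M (k + 1))
    (E : MultivectorField n M k) (f : Fin (k + (k + 1)) → C^∞⟮𝓡 n, M; 𝓘(ℝ, ℝ), ℝ⟯) (x : M) :
    (∑ σ : Equiv.Perm (Fin (k + (k + 1))), ((Equiv.Perm.sign σ : ℤ) : ℝ) •
      genJacobiBracket Λ E (Fin.snoc (α := fun _ => C^∞⟮𝓡 n, M; 𝓘(ℝ, ℝ), ℝ⟯)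
        (fun i : Fin k => f (σ (Fin.castAdd (k + 1) i)))
        (genJacobiBracket Λ E (fun i : Fin (k + 1) => f (σ (Fin.natAdd k i)))))) x =
    ∑ σ : Equiv.Perm (Fin (k + (k + 1))), ((Equiv.Perm.sign σ : ℤ) : ℝ) *
      coordBracket (coordRep n Λ.toFun x) (coordRep n E.toFun x)
        (Fin.snoc (α := fun _ => CoordSpace n → ℝ)
          (fun i => f (σ (Fin.castAdd (k + 1) i)) ∘ (extChartAt (𝓡 n) x).symm)
          (coordBracket (coordRep n Λ.toFun x) (coordRep n E.toFun x)
            fun i => f (σ (Fin.natAdd k i)) ∘ (extChartAt (𝓡 n) x).symm))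
        (extChartAt (𝓡 n) x x) := by
  have hy := mem_extChartAt_target (I := 𝓡 n) x
  have hval : ∀ g : C^∞⟮𝓡 n, M; 𝓘(ℝ, ℝ), ℝ⟯,
      g x = g ((extChartAt (𝓡 n) x).symm (extChartAt (𝓡 n) x x)) := fun g => by
    rw [extChartAt_to_inv]
  refine (map_sum (ContMDiffMap.evalRingHom x) _ _).trans (Finset.sum_congr rfl fun σ _ => ?_)
  refine congrArg (fun t : ℝ => ((Equiv.Perm.sign σ : ℤ) : ℝ) * t) ?_
  refine (hval _).trans ((genJacobiBracket_symm_apply Λ E _ x hy).trans ?_)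
  refine coordBracket_congr _ _ fun i => ?_
  refine Fin.lastCases ?_ (fun i => ?_) i
  · simp only [Fin.snoc_last]
    filter_upwards [(isOpen_extChartAt_target (I := 𝓡 n) x).mem_nhds hy] with y hy'
    exact genJacobiBracket_symm_apply Λ E _ x hy'
  · simp only [Fin.snoc_castSucc]
    exact Filter.EventuallyEq.rfl

/-- Every `1`-jet at a point is the `1`-jet of a globally defined smooth function. -/
theorem exists_smooth_coordJet_eq [T2Space M] (x : M) (a : ℝ) (α : CoordDual n) :
    ∃ f : C^∞⟮𝓡 n, M; 𝓘(ℝ, ℝ), ℝ⟯,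
      coordJet (f ∘ (extChartAt (𝓡 n) x).symm) (extChartAt (𝓡 n) x x) = (a, α) := by
  obtain ⟨ψ⟩ : Nonempty (SmoothBumpFunction (𝓡 n) x) := inferInstance
  let y₀ := extChartAt (𝓡 n) x x
  -- The affine function with the prescribed jet in the chart; the cutoff by ψ leaves it unchanged
  -- near x.
  let g : M → ℝ := fun z => a + α (extChartAt (𝓡 n) x z - y₀)
  have hg : ContMDiffOn (𝓡 n) 𝓘(ℝ, ℝ) ∞ g (chartAt (EuclideanSpace ℝ (Fin n)) x).source := by
    have hα : ContDiff ℝ ∞ (fun y : CoordSpace n => a + α (y - y₀)) := by fun_prop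
    exact hα.contMDiff.comp_contMDiffOn contMDiffOn_extChartAt
  refine ⟨⟨fun z => ψ z • g z, ψ.contMDiff_smul hg⟩, ?_⟩
  have hy := mem_extChartAt_target (I := 𝓡 n) x
  have hev : ((fun z => ψ z • g z) ∘ (extChartAt (𝓡 n) x).symm) =ᶠ[nhds y₀]
      fun y => a + α (y - y₀) := by
    have hcont : Filter.Tendsto (extChartAt (𝓡 n) x).symm (nhds y₀) (nhds x) := by
      have := (continuousAt_extChartAt_symm (I := 𝓡 n) x).tendsto
      rwa [extChartAt_to_inv] at this
    filter_upwards [(isOpen_extChartAt_target (I := 𝓡 n) x).mem_nhds hy,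
      hcont.eventually ψ.eventuallyEq_one] with y hy' h1
    simp only [Function.comp_apply, g]
    rw [h1, (extChartAt (𝓡 n) x).right_inv hy']
    simp
  refine Prod.ext ?_ ?_
  · refine hev.eq_of_nhds.trans ?_
    simp
  · refine hev.fderiv_eq.trans ?_
    have : HasFDerivAt (fun y => a + α (y - y₀)) α y₀ :=
      (α.hasFDerivAt.comp y₀ ((hasFDerivAt_id y₀).sub_const y₀)).const_add a
    exact this.fderiv

theorem mfderiv_extChartAt_symm_comp_self (x : M) :
    (mfderiv 𝓘(ℝ, EuclideanSpace ℝ (Fin n)) (𝓡 n) (extChartAt (𝓡 n) x).symm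
      (extChartAt (𝓡 n) x x) : CoordSpace n →L[ℝ] CoordSpace n).comp
      (mfderiv (𝓡 n) 𝓘(ℝ, EuclideanSpace ℝ (Fin n)) (extChartAt (𝓡 n) x) x :
        CoordSpace n →L[ℝ] CoordSpace n) = ContinuousLinearMap.id ℝ (CoordSpace n) := by
  have h := mfderivWithin_extChartAt_symm_comp_mfderiv_extChartAt' (I := 𝓡 n)
    (mem_extChartAt_source (I := 𝓡 n) x)
  rw [ModelWithCorners.range_eq_univ, mfderivWithin_univ] at h
  exact h

theorem mfderiv_extChartAt_comp_symm_self (x : M) :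
    (mfderiv (𝓡 n) 𝓘(ℝ, EuclideanSpace ℝ (Fin n)) (extChartAt (𝓡 n) x) x :
        CoordSpace n →L[ℝ] CoordSpace n).comp
    (mfderiv 𝓘(ℝ, EuclideanSpace ℝ (Fin n)) (𝓡 n) (extChartAt (𝓡 n) x).symm
      (extChartAt (𝓡 n) x x) : CoordSpace n →L[ℝ] CoordSpace n) =
      ContinuousLinearMap.id ℝ (CoordSpace n) := by
  have h := mfderiv_extChartAt_comp_mfderivWithin_extChartAt_symm' (I := 𝓡 n)
    (mem_extChartAt_source (I := 𝓡 n) x)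
  rw [ModelWithCorners.range_eq_univ, mfderivWithin_univ] at h
  exact h

theorem chartPullback_chartPushforward (x : M) (α : Cotangent n x) :
    chartPullback n x x (chartPushforward n x α) = α := by
  refine ContinuousLinearMap.ext fun u => ?_
  exact congrArg α (congrArg (fun φ : CoordSpace n →L[ℝ] CoordSpace n => φ u)
    (mfderiv_extChartAt_symm_comp_self x))

/-- Surjectivity makes pullback of forms injective, so identities between forms at x can be checked
in the chart. -/
theorem chartPushforward_surjective (x : M) : Function.Surjective (chartPushforward n x) := by
  intro γ
  refine ⟨chartPullback n x x γ, ContinuousLinearMap.ext fun u => ?_⟩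
  exact congrArg γ (congrArg (fun φ : CoordSpace n →L[ℝ] CoordSpace n => φ u)
    (mfderiv_extChartAt_comp_symm_self x))

theorem coordRep_compLinearMap_chartPushforward {k : ℕ}
    (P : ∀ x : M, Cotangent n x [⋀^Fin k]→L[ℝ] ℝ) (x : M) :
    (coordRep n P x (extChartAt (𝓡 n) x x)).toAlternatingMap.compLinearMap
      (chartPushforward n x).toLinearMap = (P x).toAlternatingMap := by
  ext α
  -- Applying the inverse chart to the image of x returns x only up to a propositional equality, on
  -- which the type of covectors depends; hence the generalisation to w.
  have key : ∀ w : M, w = x →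
      P w (fun i => chartPullback n x w (chartPushforward n x (α i))) = P x α := by
    rintro w rfl
    exact congrArg (P w) (funext fun i => chartPullback_chartPushforward w (α i))
  exact key _ (extChartAt_to_inv x)

theorem wedge_eq_coordRep {a b : ℕ} (P : MultivectorField n M a) (Q : MultivectorField n M b)
    (x : M) : P.wedge Q x = (wedge (coordRep n P.toFun x (extChartAt (𝓡 n) x x)).toAlternatingMap
      (coordRep n Q.toFun x (extChartAt (𝓡 n) x x)).toAlternatingMap).compLinearMap
        (chartPushforward n x).toLinearMap := by
  rw [wedge_compLinearMap, coordRep_compLinearMap_chartPushforward,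
    coordRep_compLinearMap_chartPushforward]
  rfl

theorem schouten_iff_coordSchouten {m : ℕ} (Λ : MultivectorField n M (m + 2))
    (E : MultivectorField n M (m + 1)) (c : ℝ) (x : M) :
    (Λ.schouten Λ x = c • E.wedge Λ x ∧ E.schouten Λ x = 0) ↔
      coordSchouten (coordRep n Λ.toFun x) (coordRep n Λ.toFun x) (extChartAt (𝓡 n) x x) =
        c • wedge (coordRep n E.toFun x (extChartAt (𝓡 n) x x)).toAlternatingMap
          (coordRep n Λ.toFun x (extChartAt (𝓡 n) x x)).toAlternatingMap ∧
      coordSchouten (coordRep n E.toFun x) (coordRep n Λ.toFun x) (extChartAt (𝓡 n) x x) = 0 := by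
  rw [wedge_eq_coordRep]
  unfold MultivectorField.schouten
  exact and_congr (compLinearMap_eq_smul_iff (chartPushforward_surjective x) _ _ c)
    (compLinearMap_eq_zero_iff (chartPushforward_surjective x) _)

end ManifoldJets

/-! ### The characterization -/

theorem lemma3p1 {n : ℕ} {M : Type*} [TopologicalSpace M] [T2Space M]
    [ChartedSpace (EuclideanSpace ℝ (Fin n)) M] [IsManifold (𝓡 n) ∞ M]
    (p m : ℕ) (hp : 2 * p = m + 2)
    (Λ : MultivectorField n M (m + 2)) (E : MultivectorField n M (m + 1)) :
    GenJacobiIdentity (genJacobiBracket Λ E) ↔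
      (∀ x : M, Λ.schouten Λ x = (2 * (2 * (p : ℝ) - 1)) • E.wedge Λ x) ∧
        (∀ x : M, E.schouten Λ x = 0) := by
  have hm : Odd (m + 1) := ⟨p - 1, by omega⟩
  have hc : 2 * (2 * (p : ℝ) - 1) = 2 * ((m + 1 : ℕ) : ℝ) := by
    have : (2 : ℝ) * p = m + 2 := by exact_mod_cast hp
    push_cast
    linarith
  rw [hc, ← forall_and]
  simp only [schouten_iff_coordSchouten, ← coordSchouten_iff hm]
  have hdiff : ∀ {k : ℕ} (P : MultivectorField n M k) (x : M),
      DifferentiableAt ℝ (coordRep n P.toFun x) (extChartAt (𝓡 n) x x) := fun P x =>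
    ((P.smooth x).differentiableOn (by simp)).differentiableAt
      ((isOpen_extChartAt_target (I := 𝓡 n) x).mem_nhds (mem_extChartAt_target x))
  have hsum : ∀ (f : Fin (m + 1 + (m + 1 + 1)) → C^∞⟮𝓡 n, M; 𝓘(ℝ, ℝ), ℝ⟯) (x : M), _ :=
    fun f x => (jacobi_sum_apply Λ E f x).trans (coord_jacobi_sum hm (hdiff Λ x) (hdiff E x)
      (fun i => f i ∘ (extChartAt (𝓡 n) x).symm) fun i =>
        (contDiffOn_comp_extChartAt_symm (f i).contMDiff x).contDiffAt
          ((isOpen_extChartAt_target (I := 𝓡 n) x).mem_nhds (mem_extChartAt_target x)))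
  have h0 : (((m + 1).factorial * (m + 1 + 1).factorial : ℕ) : ℝ) ≠ 0 :=
    Nat.cast_ne_zero.2 (Nat.mul_ne_zero (Nat.factorial_ne_zero _) (Nat.factorial_ne_zero _))
  constructor
  · intro h x
    refine (jetForm_jacobi_iff hm _ _ _ _ _).1 fun v => ?_
    -- The jets at x can be prescribed independently for each function, so the identity at x tests η
    -- on arbitrary vectors.
    choose f hf using fun i => exists_smooth_coordJet_eq x (v i).1 (v i).2
    have hfx := (hsum f x).symm.trans (congrArg (fun g : C^∞⟮𝓡 n, M; 𝓘(ℝ, ℝ), ℝ⟯ => g x) (h f))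
    simp only [hf] at hfx
    exact (mul_eq_zero.1 hfx).resolve_left h0
  · intro h f
    refine ContMDiffMap.ext fun x => (hsum f x).trans ?_
    rw [(jetForm_jacobi_iff hm _ _ _ _ _).2 (h x), mul_zero]
    rfl
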